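/- Let $(\Omega,\Sigma,\mu)$ be a probability space, and let $X$ be a Banach lattice of functions on it: $X$ is an ideal of $L_1(\mu)$ (a linear subspace such that $f\in L_1(\mu)$, $|f|\le|g|$ a.e. and $g\in X$ imply $f\in X$) with a complete norm such that $|f|\le|g|$ a.e. implies $\|f\|_X\le\|g\|_X$, the space $L_\infty(\mu)$ is contained in $X$ and dense in it, and $\|f\|_1\le\|f\|_X\le 2\|f\|_\infty$ for all $f\in L_\infty(\mu)$. Write $S(\cdot)$ for the unit sphere and $\rho_X(\tau)=\sup\{\frac12(\|x+\tau y\|+\|x-\tau y\|)-1:\|x\|=\|y\|=1\}$ for the modulus of smoothness of $X$. Assume that $X$ is uniformly convex, and uniformly smooth, i.e. $\rho_X(\tau)/\tau\to0$ as $\tau\to0^+$. For $h\in L_\infty(\mu)$ and $f\in X$ put $E(h,f)=\int|h|\log|f|\,d\mu\in[-\infty,\infty)$, where $\log 0=-\infty$ and the integrand is $0$ where $h=0$. Then for each $h\in S(L_1(\mu))\cap L_\infty(\mu)$ there is a unique $f_h\in S(X)$, $f_h\ge0$, at which $E(h,\cdot)$ attains its maximum over $\{k\in X:k\ge0,\ \|k\|_X\le1\}$,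 and the map $h\mapsto \operatorname{sign}(h)\,f_h$ extends uniquely to a continuous map $F_X:S(L_1(\mu))\to S(X)$, the entropy map. Moreover: 1. $F_X$ is a uniform homeomorphism of $S(L_1(\mu))$ onto $S(X)$ (a bijection such that $F_X$ and $F_X^{-1}$ are uniformly continuous). 2. $F_X^{-1}$ has a modulus of continuity depending only on the modulus of smoothness of $X$: for every function $\rho$ there is a continuous $m:[0,\infty)\to[0,\infty)$ with $m(0)=0$ such that, for all $(\Omega,\Sigma,\mu)$ and $X$ as above with $\rho_X=\rho$, $\|F_X^{-1}(x)-F_X^{-1}(y)\|_1\le m(\|x-y\|_X)$ for all $x,y\in S(X)$. 3. Every $x\in S(X)$ has a unique supporting functional $x^*\in X^*$ ($\|x^*\|=1=x^*(x)$). It is given by a measurable function, again written $x^*$, as $x^*(y)=\int x^*y\,d\mu$ for $y\in X$ (with $x^*y$ integrable), and $F_X^{-1}(x)=|x^*|\cdot x$ (pointwise product). -/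

import Mathlib

open MeasureTheory Filter Topology Metric
open scoped NNReal ENNReal

universe u v

/-- A representation of the Banach space `X` as a Banach lattice of functions on `(Ω, Σ, μ)`: an
injective linear map `toLp` from `X` into `L₁(μ)` whose range is an ideal, such that the norm of
`X` is a lattice norm for the order inherited from `L₁(μ)`, `L_∞(μ)` is contained and dense in
`X`, and `‖f‖₁ ≤ ‖f‖_X ≤ 2 ‖f‖_∞` for `f` in `L_∞(μ)`. (As `L_∞(μ)` is dense in `L₁(μ)`, so is `X`.)
Completeness of `X` is a separate hypothesis. -/
structure FunctionLattice {Ω : Type u} [MeasurableSpace Ω] (μ : Measure Ω)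
    (X : Type v) [NormedAddCommGroup X] [NormedSpace ℝ X] where
  /-- the class of functions that represents an element of `X` -/
  toLp : X →ₗ[ℝ] Lp ℝ 1 μ
  injective : Function.Injective toLp
  ideal : ∀ (x : X) (f : Lp ℝ 1 μ), |f| ≤ |toLp x| → ∃ y : X, toLp y = f
  norm_le_norm : ∀ x y : X, |toLp x| ≤ |toLp y| → ‖x‖ ≤ ‖y‖
  bounded_mem : ∀ f : Lp ℝ 1 μ, MemLp f ∞ μ → ∃ x : X, toLp x = f
  dense_bounded : Dense {x : X | MemLp (toLp x) ∞ μ}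
  norm_one_le : ∀ x : X, MemLp (toLp x) ∞ μ → ‖toLp x‖ ≤ ‖x‖
  norm_le_top : ∀ x : X, MemLp (toLp x) ∞ μ → ‖x‖ ≤ 2 * (eLpNorm (toLp x) ∞ μ).toReal

/-- The modulus of smoothness
`ρ_X(τ) = sup {(‖x + τ y‖ + ‖x - τ y‖) / 2 - 1 : ‖x‖ = ‖y‖ = 1}`. -/
noncomputable def smoothnessModulus (X : Type v) [NormedAddCommGroup X] [NormedSpace ℝ X]
    (τ : ℝ) : ℝ :=
  sSup {r : ℝ | ∃ x y : X, ‖x‖ = 1 ∧ ‖y‖ = 1 ∧ r = (‖x + τ • y‖ + ‖x - τ • y‖) / 2 - 1}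

/-- `X` is uniformly smooth: `ρ_X(τ) / τ → 0` as `τ → 0⁺`. -/
def IsUniformlySmooth (X : Type v) [NormedAddCommGroup X] [NormedSpace ℝ X] : Prop :=
  Tendsto (fun τ : ℝ => smoothnessModulus X τ / τ) (𝓝[>] 0) (𝓝 0)

/-- The entropy `E(h, f) = ∫ |h| log |f| dμ` with values in the extended reals: the integral of the
positive part minus the integral of the negative part. Here `log 0 = -∞`, and the integrand is `0`
where `h = 0`. For bounded `h` and integrable `f` the first integral is finite. -/
noncomputable def entropy {Ω : Type u} [MeasurableSpace Ω] (μ : Measure Ω) (h f : Ω → ℝ) : EReal :=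
  ((∫⁻ ω, ‖h ω‖ₑ * (ENNReal.log ‖f ω‖ₑ).toENNReal ∂μ : ℝ≥0∞) : EReal) -
    ((∫⁻ ω, ‖h ω‖ₑ * (-ENNReal.log ‖f ω‖ₑ).toENNReal ∂μ : ℝ≥0∞) : EReal)

namespace FunctionLattice

variable {Ω : Type u} [MeasurableSpace Ω] {μ : Measure Ω}
  {X : Type v} [NormedAddCommGroup X] [NormedSpace ℝ X]

/-- `f ∈ S(X)⁺` and `E(h, f)` is the maximum of `E(h, k)` over `k` in the positive part of the unit
ball of `X`. -/
def IsEntropyMaximizer (R : FunctionLattice μ X) (h : Ω → ℝ) (f : X) : Prop :=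
  0 ≤ R.toLp f ∧ ‖f‖ = 1 ∧
    ∀ k : X, 0 ≤ R.toLp k → ‖k‖ ≤ 1 → entropy μ h (R.toLp k) ≤ entropy μ h (R.toLp f)

/-- `F : S(L₁(μ)) → S(X)` is an entropy map: it is continuous, and for every bounded `h` in
`S(L₁(μ))` it satisfies `F h = sign h · f`, where `f` maximizes `E(|h|, ·) = E(h, ·)`. -/
def IsEntropyMap (R : FunctionLattice μ X)
    (F : sphere (0 : Lp ℝ 1 μ) 1 → sphere (0 : X) 1) : Prop :=
  Continuous F ∧
    ∀ h : sphere (0 : Lp ℝ 1 μ) 1, MemLp (h : Lp ℝ 1 μ) ∞ μ →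
      ∃ f : X, R.IsEntropyMaximizer (h : Lp ℝ 1 μ) f ∧
        R.toLp (F h : X) =ᵐ[μ] fun ω => Real.sign ((h : Lp ℝ 1 μ) ω) * R.toLp f ω

/-- The functional `φ ∈ X*` is integration against the function `g`. -/
def Represents (R : FunctionLattice μ X) (g : Ω → ℝ) (φ : StrongDual ℝ X) : Prop :=
  AEStronglyMeasurable g μ ∧
    ∀ y : X, Integrable (fun ω => g ω * R.toLp y ω) μ ∧ φ y = ∫ ω, g ω * R.toLp y ω ∂μ

end FunctionLattice

/-- `φ ∈ S(X*)` is a supporting functional of `x ∈ S(X)`. -/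
def IsSupportingFunctional {X : Type v} [NormedAddCommGroup X] [NormedSpace ℝ X]
    (φ : StrongDual ℝ X) (x : X) : Prop :=
  ‖φ‖ = 1 ∧ φ x = 1

/-! The entropy map is built as the inverse of the polar map `G x = |x*| x` from `S(X)` to
`S(L₁(μ))`; everything reduces to `G` being a uniform embedding with dense range.

`G` makes sense because uniform convexity makes the lattice norm order continuous, so that every
functional has a density by Radon–Nikodym (`exists_represents`), while smoothness makes the
supporting functional unique. `G` is uniformly continuous because smoothness controls `‖x* - y*‖` by
`‖x - y‖` (`IsSupportingFunctional.norm_sub_mul_le`), and `integral_polar_sub_le` turns this into a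
bound in `L₁`; only `ρ_X` enters, whence the universal modulus. The inverse is uniformly continuous
because, if `|x*| x` and `|y*| y` are close in `L₁`, then testing `|x*|` and `|y*|` on `|x| + |y|`
shows that `‖|x| + |y|‖` is almost `2`, and uniform convexity applies
(`exists_norm_sub_lt_of_polar`).

The range contains every bounded `h`. Near-maximizers of `E(h, ·)` have midpoints of norm almost
`1`, since `log` is concave, so uniform convexity gives a unique maximizer `f`. The first variation
of the entropy at `f` says that `h / f` has norm at most `1` in the dual (`lintegral_mul_div_le`),
hence supports `x = sign h · f`, and `G x = h` (`exists_polar_of_maximizer`). Bounded functions are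
dense in `S(L₁(μ))`, and the range of `G` is complete, so `G` is onto. -/

theorem exists_monotone_simpleFunc_tendsto {Ω : Type u} [MeasurableSpace Ω] {f : Ω → ℝ}
    (hf : Measurable f) (h0 : ∀ ω, 0 ≤ f ω) :
    ∃ s : ℕ → SimpleFunc Ω ℝ, (∀ ω, Monotone fun n => s n ω) ∧ (∀ n ω, 0 ≤ s n ω) ∧
      (∀ n ω, s n ω ≤ f ω) ∧ ∀ ω, Tendsto (fun n => s n ω) atTop (𝓝 (f ω)) := by
  set F : Ω → ℝ≥0∞ := fun ω => ENNReal.ofReal (f ω) with hF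
  have hFm : Measurable F := hf.ennreal_ofReal
  have hle : ∀ n ω, SimpleFunc.eapprox F n ω ≤ F ω := fun n ω => by
    rw [← SimpleFunc.iSup_eapprox_apply hFm]
    exact le_iSup (fun n => SimpleFunc.eapprox F n ω) n
  refine ⟨fun n => (SimpleFunc.eapprox F n).map ENNReal.toReal, fun ω n m hnm => ?_,
    fun n ω => ENNReal.toReal_nonneg, fun n ω => ?_, fun ω => ?_⟩
  · exact ENNReal.toReal_mono (SimpleFunc.eapprox_lt_top F m ω).ne
      (SimpleFunc.monotone_eapprox F hnm ω)
  · exact ENNReal.toReal_le_of_le_ofReal (h0 ω) (hle n ω)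
  · have := (ENNReal.tendsto_toReal (a := F ω) ENNReal.ofReal_ne_top).comp
      (SimpleFunc.tendsto_eapprox hFm ω)
    rwa [hF, ENNReal.toReal_ofReal (h0 ω)] at this

/-! ### Calculus in the function lattice, and order continuity of its norm. -/

namespace FunctionLattice

section Basic

variable {Ω : Type u} [MeasurableSpace Ω] {μ : Measure Ω}
  {X : Type v} [NormedAddCommGroup X] [NormedSpace ℝ X] (R : FunctionLattice μ X)

theorem coeFn_add (x y : X) :
    R.toLp (x + y) =ᵐ[μ] fun ω => R.toLp x ω + R.toLp y ω := by
  rw [map_add]; exact Lp.coeFn_add _ _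

theorem coeFn_sub (x y : X) :
    R.toLp (x - y) =ᵐ[μ] fun ω => R.toLp x ω - R.toLp y ω := by
  rw [map_sub]; exact Lp.coeFn_sub _ _

theorem coeFn_smul (c : ℝ) (x : X) :
    R.toLp (c • x) =ᵐ[μ] fun ω => c * R.toLp x ω := by
  rw [map_smul]; exact Lp.coeFn_smul _ _

theorem coeFn_sum {ι : Type*} (t : Finset ι) (x : ι → X) :
    R.toLp (∑ i ∈ t, x i) =ᵐ[μ] fun ω => ∑ i ∈ t, R.toLp (x i) ω := by
  rw [map_sum]
  refine (Lp.coeFn_finsetSum t fun i => R.toLp (x i)).trans ?_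
  exact Eventually.of_forall fun ω => by simp

theorem ext_ae {x y : X} (h : R.toLp x =ᵐ[μ] R.toLp y) : x = y :=
  R.injective (Lp.ext h)

theorem measurable_coeFn (x : X) : Measurable (R.toLp x) :=
  (Lp.stronglyMeasurable _).measurable

theorem integrable_coeFn (x : X) : Integrable (R.toLp x) μ := L1.integrable_coeFn _

theorem nonneg_iff (x : X) : 0 ≤ R.toLp x ↔ ∀ᵐ ω ∂μ, 0 ≤ R.toLp x ω := by
  rw [← Lp.coeFn_nonneg]; rfl

theorem norm_le_of_ae_le {x y : X} (h : ∀ᵐ ω ∂μ, |R.toLp x ω| ≤ |R.toLp y ω|) : ‖x‖ ≤ ‖y‖ := by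
  refine R.norm_le_norm x y ((Lp.coeFn_le _ _).1 ?_)
  filter_upwards [h, Lp.coeFn_abs (R.toLp x), Lp.coeFn_abs (R.toLp y)] with ω h1 h2 h3
  rw [h2, h3]; exact h1

theorem norm_eq_of_ae_eq {x y : X} (h : ∀ᵐ ω ∂μ, |R.toLp x ω| = |R.toLp y ω|) : ‖x‖ = ‖y‖ :=
  le_antisymm (R.norm_le_of_ae_le (h.mono fun _ h => h.le))
    (R.norm_le_of_ae_le (h.mono fun _ h => h.ge))

theorem exists_of_ae_le (x : X) {f : Ω → ℝ} (hf : AEStronglyMeasurable f μ)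
    (h : ∀ᵐ ω ∂μ, |f ω| ≤ |R.toLp x ω|) : ∃ y : X, R.toLp y =ᵐ[μ] f := by
  have hi : Integrable f μ := (R.integrable_coeFn x).mono hf h
  obtain ⟨y, hy⟩ := R.ideal x hi.toL1 (by
    refine (Lp.coeFn_le _ _).1 ?_
    filter_upwards [h, Lp.coeFn_abs (R.toLp x), Lp.coeFn_abs hi.toL1, hi.coeFn_toL1]
      with ω h1 h2 h3 h4
    rw [h2, h3, h4]; exact h1)
  exact ⟨y, hy ▸ hi.coeFn_toL1⟩

theorem exists_abs (x : X) : ∃ y : X, R.toLp y =ᵐ[μ] (fun ω => |R.toLp x ω|) ∧ ‖y‖ = ‖x‖ := by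
  obtain ⟨y, hy⟩ := R.exists_of_ae_le x (f := fun ω => |R.toLp x ω|)
    (R.measurable_coeFn x).abs.aestronglyMeasurable (by simp)
  exact ⟨y, hy, R.norm_eq_of_ae_eq (hy.mono fun ω h => by rw [h, abs_abs])⟩

theorem exists_of_bound [IsFiniteMeasure μ] {f : Ω → ℝ} (hf : AEStronglyMeasurable f μ) (C : ℝ)
    (h : ∀ᵐ ω ∂μ, |f ω| ≤ C) : ∃ y : X, R.toLp y =ᵐ[μ] f ∧ MemLp (R.toLp y) ∞ μ := by
  have hi : Integrable f μ := Integrable.of_bound hf C h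
  have hm : MemLp hi.toL1 ∞ μ := by
    refine MemLp.ae_eq hi.coeFn_toL1.symm (memLp_top_of_bound hf C h)
  obtain ⟨y, hy⟩ := R.bounded_mem hi.toL1 hm
  exact ⟨y, hy ▸ hi.coeFn_toL1, hy ▸ hm⟩

theorem exists_simpleFunc [IsFiniteMeasure μ] (s : SimpleFunc Ω ℝ) :
    ∃ y : X, R.toLp y =ᵐ[μ] s ∧ MemLp (R.toLp y) ∞ μ := by
  obtain ⟨C, hC⟩ := s.exists_forall_norm_le
  exact R.exists_of_bound s.aestronglyMeasurable C (Eventually.of_forall hC)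

theorem norm_toLp_eq (x : X) : ‖R.toLp x‖ = ∫ ω, |R.toLp x ω| ∂μ := L1.norm_eq_integral_norm _

/-- The structure assumes this bound for bounded elements only; simple functions increasing to `|x|`
carry it over to all of `X`. -/
theorem norm_toLp_le [IsFiniteMeasure μ] (x : X) : ‖R.toLp x‖ ≤ ‖x‖ := by
  obtain ⟨s, -, hs0, hsle, hst⟩ := exists_monotone_simpleFunc_tendsto
    (R.measurable_coeFn x).abs (fun ω => abs_nonneg _)
  choose y hy hyb using fun n => R.exists_simpleFunc (s n)
  have hb : ∀ n, ∫ ω, s n ω ∂μ ≤ ‖x‖ := fun n => by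
    have h1 : ‖R.toLp (y n)‖ = ∫ ω, s n ω ∂μ := by
      rw [norm_toLp_eq]
      exact integral_congr_ae ((hy n).mono fun ω h => by
        simp only [h]; exact abs_of_nonneg (hs0 n ω))
    rw [← h1]
    exact (R.norm_one_le _ (hyb n)).trans (R.norm_le_of_ae_le ((hy n).mono fun ω h => by
      rw [h, abs_of_nonneg (hs0 n ω)]; exact hsle n ω))
  rw [norm_toLp_eq]
  refine le_of_tendsto' (tendsto_integral_of_dominated_convergence (fun ω => |R.toLp x ω|)
    (fun n => (s n).aestronglyMeasurable) (R.integrable_coeFn x).abs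
    (fun n => Eventually.of_forall fun ω => ?_) (Eventually.of_forall hst)) hb
  rw [Real.norm_eq_abs, abs_of_nonneg (hs0 n ω)]
  exact hsle n ω

theorem continuous_toLp [IsFiniteMeasure μ] : Continuous R.toLp :=
  (R.toLp.mkContinuous 1 (by simpa using R.norm_toLp_le)).continuous

theorem exists_subseq_tendsto_ae [IsFiniteMeasure μ] {x : ℕ → X} {y : X}
    (h : Tendsto x atTop (𝓝 y)) : ∃ ns : ℕ → ℕ, StrictMono ns ∧
      ∀ᵐ ω ∂μ, Tendsto (fun i => R.toLp (x (ns i)) ω) atTop (𝓝 (R.toLp y ω)) :=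
  (tendstoInMeasure_of_tendsto_Lp
    ((R.continuous_toLp.tendsto y).comp h)).exists_seq_tendsto_ae

/-- The norm of a uniformly convex function lattice is order continuous. -/
theorem tendsto_zero_of_antitone [IsFiniteMeasure μ] [CompleteSpace X] [UniformConvexSpace X]
    {x : ℕ → X}
    (hmono : ∀ n m, n ≤ m → ∀ᵐ ω ∂μ, 0 ≤ R.toLp (x m) ω ∧ R.toLp (x m) ω ≤ R.toLp (x n) ω)
    (hlim : ∀ᵐ ω ∂μ, Tendsto (fun n => R.toLp (x n) ω) atTop (𝓝 0)) :
    Tendsto x atTop (𝓝 0) := by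
  have hanti : Antitone fun n => ‖x n‖ := fun n m hnm =>
    R.norm_le_of_ae_le ((hmono n m hnm).mono fun ω h => by
      rw [abs_of_nonneg h.1, abs_of_nonneg (h.1.trans h.2)]; exact h.2)
  obtain ⟨c, hc0, hc⟩ : ∃ c, 0 ≤ c ∧ Tendsto (fun n => ‖x n‖) atTop (𝓝 c) := by
    have := tendsto_atTop_ciInf hanti ⟨0, by rintro _ ⟨n, rfl⟩; exact norm_nonneg _⟩
    exact ⟨_, le_ciInf fun n => norm_nonneg _, this⟩
  have hge : ∀ n, c ≤ ‖x n‖ := fun n => hanti.le_of_tendsto hc n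
  rcases hc0.eq_or_lt with rfl | hcpos
  · exact tendsto_zero_iff_norm_tendsto_zero.2 hc
  exfalso
  -- For `n ≥ N` the sum `x n + x N` dominates `2 x n`, so its norm is at least `2 c`, nearly twice
  -- `‖x N‖`; uniform convexity then makes `x n` and `x N` close.
  have hcauchy : CauchySeq x := by
    rw [Metric.cauchySeq_iff']
    intro ε hε
    have hx0 : 0 < ‖x 0‖ := hcpos.trans_le (hge 0)
    obtain ⟨δ, hδ, hUC⟩ := exists_forall_closed_ball_dist_add_le_two_sub X (div_pos hε hx0)
    -- The factor `1 + δ / 2` is chosen so that `(2 - δ) (1 + δ / 2) < 2`. Separation `ε / ‖x 0‖`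
    -- was used above so that `δ` does not depend on `N`: after division by `‖x N‖ ≤ ‖x 0‖`, vectors
    -- at distance `ε` are at least that far apart.
    obtain ⟨N, hN⟩ := (hc.eventually (gt_mem_nhds
      (show c < c * (1 + δ / 2) by nlinarith [mul_pos hcpos hδ]))).exists
    refine ⟨N, fun n hn => ?_⟩
    set r := ‖x N‖ with hr
    have hrpos : 0 < r := hcpos.trans_le (hge N)
    have hnr : ‖x n‖ ≤ r := hanti hn
    by_contra! hcon
    have h1 : ∀ z : X, ‖r⁻¹ • z‖ = ‖z‖ / r := fun z => by
      rw [norm_smul, norm_inv, Real.norm_of_nonneg hrpos.le]; field_simp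
    have h2 := hUC (x := r⁻¹ • x n) (by rw [h1]; exact (div_le_one hrpos).2 hnr)
      (y := r⁻¹ • x N) (by rw [h1, ← hr, div_self hrpos.ne']) (by
        rw [← smul_sub, h1, ← dist_eq_norm]
        have : r ≤ ‖x 0‖ := hanti (Nat.zero_le N)
        gcongr)
    rw [← smul_add, h1] at h2
    have h3 : ‖(2 : ℝ) • x n‖ ≤ ‖x n + x N‖ := by
      refine R.norm_le_of_ae_le ?_
      filter_upwards [hmono N n hn, R.coeFn_smul 2 (x n), R.coeFn_add (x n) (x N)]
        with ω h4 h5 h6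
      rw [h5, h6, abs_of_nonneg (by linarith), abs_of_nonneg (by linarith)]
      linarith
    rw [norm_smul, Real.norm_of_nonneg (by norm_num)] at h3
    have h4 := hge n
    rw [div_le_iff₀ hrpos] at h2
    nlinarith
  obtain ⟨y, hy⟩ := cauchySeq_tendsto_of_complete hcauchy
  obtain ⟨ns, hns, hae⟩ := R.exists_subseq_tendsto_ae hy
  have : y = 0 := by
    refine R.ext_ae ?_
    rw [map_zero]
    filter_upwards [hae, hlim, Lp.coeFn_zero ℝ 1 μ] with ω h1 h2 h3
    rw [h3]
    exact tendsto_nhds_unique h1 (h2.comp hns.tendsto_atTop)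
  rw [this] at hy
  have := tendsto_nhds_unique hc (by simpa using hy.norm)
  exact hcpos.ne' this

/-- Positive elements are limits of increasing sequences of simple functions. -/
theorem exists_simpleFunc_tendsto [IsFiniteMeasure μ] [CompleteSpace X] [UniformConvexSpace X]
    {y : X} (hy : ∀ᵐ ω ∂μ, 0 ≤ R.toLp y ω) :
    ∃ (s : ℕ → SimpleFunc Ω ℝ) (x : ℕ → X), (∀ ω, Monotone fun n => s n ω) ∧
      (∀ n ω, 0 ≤ s n ω) ∧ (∀ᵐ ω ∂μ, ∀ n, s n ω ≤ R.toLp y ω) ∧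
      (∀ᵐ ω ∂μ, Tendsto (fun n => s n ω) atTop (𝓝 (R.toLp y ω))) ∧
      (∀ n, R.toLp (x n) =ᵐ[μ] s n) ∧ Tendsto x atTop (𝓝 y) := by
  obtain ⟨s, hsm, hs0, hsle, hst⟩ := exists_monotone_simpleFunc_tendsto
    (R.measurable_coeFn y).abs (fun ω => abs_nonneg _)
  choose x hx hxb using fun n => R.exists_simpleFunc (s n)
  have hle : ∀ᵐ ω ∂μ, ∀ n, s n ω ≤ R.toLp y ω := hy.mono fun ω h n => by
    have := hsle n ω; rwa [abs_of_nonneg h] at this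
  have ht : ∀ᵐ ω ∂μ, Tendsto (fun n => s n ω) atTop (𝓝 (R.toLp y ω)) := hy.mono fun ω h => by
    have := hst ω; rwa [abs_of_nonneg h] at this
  refine ⟨s, x, hsm, hs0, hle, ht, hx, ?_⟩
  have hd : ∀ᵐ ω ∂μ, ∀ n, R.toLp (y - x n) ω = R.toLp y ω - s n ω := by
    rw [ae_all_iff]; intro n
    filter_upwards [hx n, R.coeFn_sub y (x n)] with ω h1 h2
    rw [h2, h1]
  have h0 : Tendsto (fun n => y - x n) atTop (𝓝 0) := by
    refine R.tendsto_zero_of_antitone (fun n m hnm => ?_) ?_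
    · filter_upwards [hd, hle] with ω h1 h2
      rw [h1, h1]
      have := hsm ω hnm
      exact ⟨sub_nonneg.2 (h2 m), by simp only at this; linarith⟩
    · filter_upwards [hd, ht] with ω h1 h2
      simp only [h1]
      simpa using h2.const_sub (R.toLp y ω)
  simpa using h0.const_sub y

end Basic

end FunctionLattice

/-! ### Functionals are integration against functions. -/

namespace FunctionLattice

section Representation

variable {Ω : Type u} [MeasurableSpace Ω] {μ : Measure Ω} [IsFiniteMeasure μ]
  {X : Type v} [NormedAddCommGroup X] [NormedSpace ℝ X] (R : FunctionLattice μ X)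

/-- The indicator function of `A` as an element of `X`, and `0` if `A` is not measurable. -/
noncomputable def indicator (A : Set Ω) : X :=
  open Classical in
  if hA : MeasurableSet A then
    (R.exists_simpleFunc (SimpleFunc.piecewise A hA (SimpleFunc.const Ω 1) 0)).choose
  else 0

theorem coeFn_indicator {A : Set Ω} (hA : MeasurableSet A) :
    R.toLp (R.indicator A) =ᵐ[μ] A.indicator fun _ => 1 := by
  rw [indicator, dif_pos hA]
  refine (R.exists_simpleFunc
    (SimpleFunc.piecewise A hA (SimpleFunc.const Ω 1) 0)).choose_spec.1.trans ?_
  refine Eventually.of_forall fun ω => ?_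
  classical
  by_cases h : ω ∈ A <;> simp [h]

/-- Order continuity, applied to the decreasing remainders; it makes `A ↦ φ(1_A)` countably
additive. -/
theorem indicator_iUnion_tendsto [CompleteSpace X] [UniformConvexSpace X] {A : ℕ → Set Ω}
    (hA : ∀ i, MeasurableSet (A i)) (hd : Pairwise (Function.onFun Disjoint A)) :
    Tendsto (fun n => ∑ i ∈ Finset.range n, R.indicator (A i)) atTop
      (𝓝 (R.indicator (⋃ i, A i))) := by
  have hae : ∀ᵐ ω ∂μ, ∀ n, R.toLp (R.indicator (⋃ i, A i) -
      ∑ i ∈ Finset.range n, R.indicator (A i)) ω =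
      (⋃ i, A i).indicator (fun _ => (1 : ℝ)) ω -
        (⋃ i ∈ Finset.range n, A i).indicator (fun _ => (1 : ℝ)) ω := by
    rw [ae_all_iff]; intro n
    filter_upwards [R.coeFn_sub (R.indicator (⋃ i, A i)) (∑ i ∈ Finset.range n, R.indicator (A i)),
      R.coeFn_sum (Finset.range n) (fun i => R.indicator (A i)),
      R.coeFn_indicator (MeasurableSet.iUnion hA),
      ae_all_iff.2 fun i => R.coeFn_indicator (hA i)] with ω h1 h2 h3 h4
    rw [h1, h2, h3, Finset.indicator_biUnion_apply _ _ fun i _ j _ hij => hd hij]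
    simp only [h4]
  have h0 : Tendsto (fun n => R.indicator (⋃ i, A i) -
      ∑ i ∈ Finset.range n, R.indicator (A i)) atTop (𝓝 0) := by
    have hsub : ∀ n m, n ≤ m → (⋃ i ∈ Finset.range n, A i) ⊆ ⋃ i ∈ Finset.range m, A i :=
      fun n m hnm => Set.biUnion_subset_biUnion_left fun i hi => by
        simp only [Finset.coe_range, Set.mem_Iio] at hi ⊢
        exact hi.trans_le hnm
    have hsub' : ∀ n, (⋃ i ∈ Finset.range n, A i) ⊆ ⋃ i, A i := fun n =>
      Set.iUnion₂_subset fun i _ => Set.subset_iUnion A i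
    refine R.tendsto_zero_of_antitone (fun n m hnm => ?_) ?_
    · filter_upwards [hae] with ω h
      rw [h, h]
      have h1 := Set.indicator_le_indicator_of_subset (hsub n m hnm)
        (f := fun _ => (1 : ℝ)) (fun _ => zero_le_one) ω
      have h2 := Set.indicator_le_indicator_of_subset (hsub' m) (f := fun _ => (1 : ℝ)) (fun _ => zero_le_one) ω
      constructor <;> linarith
    · filter_upwards [hae] with ω h
      simp only [h]
      by_cases hω : ω ∈ ⋃ i, A i
      · obtain ⟨i, hi⟩ := Set.mem_iUnion.1 hω
        refine tendsto_const_nhds.congr' ?_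
        filter_upwards [eventually_gt_atTop i] with n hn
        rw [Set.indicator_of_mem hω, Set.indicator_of_mem, sub_self]
        exact Set.mem_biUnion (by simpa using hn) hi
      · refine tendsto_const_nhds.congr fun n => ?_
        rw [Set.indicator_of_notMem hω, Set.indicator_of_notMem fun h => hω (hsub' n h), sub_self]
  simpa using h0.const_sub (R.indicator (⋃ i, A i))

/-- The set function `A ↦ φ(1_A)` of a functional on a uniformly convex function lattice is a
signed measure. -/
noncomputable def signedMeasure [CompleteSpace X] [UniformConvexSpace X] (φ : StrongDual ℝ X) :
    SignedMeasure Ω where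
  measureOf' A := φ (R.indicator A)
  empty' := by
    have : R.indicator ∅ = 0 := R.ext_ae <| by
      rw [map_zero]
      filter_upwards [R.coeFn_indicator MeasurableSet.empty, Lp.coeFn_zero ℝ 1 μ] with ω h1 h2
      rw [h1, h2]; simp
    rw [this, map_zero]
  not_measurable' A hA := by rw [indicator, dif_neg hA, map_zero]
  m_iUnion' A hA hd := by
    have hs : Summable fun i => φ (R.indicator (A i)) := by
      refine Summable.of_abs <| summable_of_sum_le (c := ‖φ‖ * ‖R.indicator Set.univ‖)
        (fun i => abs_nonneg _) fun t => ?_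
      -- Attaching the signs of `φ(1_{A i})` turns the sum of absolute values into one value of `φ`,
      -- at a vector of modulus at most `1` because the sets are disjoint.
      set x : X := ∑ i ∈ t, (SignType.sign (φ (R.indicator (A i))) : ℝ) • R.indicator (A i)
      have h1 : ∑ i ∈ t, |φ (R.indicator (A i))| = φ x := by
        simp only [x, map_sum, map_smul, smul_eq_mul, sign_mul_self]
      have h2 : ‖x‖ ≤ ‖R.indicator Set.univ‖ := by
        refine R.norm_le_of_ae_le ?_
        filter_upwards [R.coeFn_indicator MeasurableSet.univ,
          R.coeFn_sum t (fun i => (SignType.sign (φ (R.indicator (A i))) : ℝ) • R.indicator (A i)),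
          ae_all_iff.2 fun i => R.coeFn_indicator (hA i),
          ae_all_iff.2 fun i => R.coeFn_smul
            (SignType.sign (φ (R.indicator (A i))) : ℝ) (R.indicator (A i))] with ω h3 h4 h5 h6
        rw [h3, h4]
        simp only [h6, h5, Set.indicator_univ, abs_one]
        calc |∑ i ∈ t, (SignType.sign (φ (R.indicator (A i))) : ℝ) *
                (A i).indicator (fun _ => (1 : ℝ)) ω|
            ≤ ∑ i ∈ t, (A i).indicator (fun _ => (1 : ℝ)) ω := by
              refine (Finset.abs_sum_le_sum_abs _ _).trans (Finset.sum_le_sum fun i _ => ?_)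
              rw [abs_mul, abs_of_nonneg (Set.indicator_nonneg (fun _ _ => zero_le_one) ω)]
              refine mul_le_of_le_one_left (Set.indicator_nonneg (fun _ _ => zero_le_one) ω) ?_
              rcases SignType.sign (φ (R.indicator (A i))) with _ | _ | _ <;> simp
          _ = (⋃ i ∈ t, A i).indicator (fun _ => (1 : ℝ)) ω :=
              (Finset.indicator_biUnion_apply _ _ (fun i _ j _ hij => hd hij) _).symm
          _ ≤ 1 := Set.indicator_le_self' (fun _ _ => zero_le_one) ω
      rw [h1]
      exact (le_abs_self _).trans ((φ.le_opNorm x).trans (by gcongr))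
    rw [hs.hasSum_iff_tendsto_nat]
    simpa [Function.comp_def] using
      (φ.continuous.tendsto _).comp (R.indicator_iUnion_tendsto hA hd)

theorem exists_density_indicator [CompleteSpace X] [UniformConvexSpace X] (φ : StrongDual ℝ X) :
    ∃ g : Ω → ℝ, Measurable g ∧ Integrable g μ ∧
      ∀ A, MeasurableSet A → φ (R.indicator A) = ∫ ω in A, g ω ∂μ := by
  have hac : R.signedMeasure φ ≪ᵥ μ.toENNRealVectorMeasure := by
    refine VectorMeasure.AbsolutelyContinuous.mk fun A hA h0 => ?_
    rw [Measure.toENNRealVectorMeasure_apply_measurable hA] at h0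
    have : R.indicator A = 0 := R.ext_ae <| by
      rw [map_zero]
      have hA0 : ∀ᵐ ω ∂μ, ω ∉ A := measure_eq_zero_iff_ae_notMem.1 h0
      filter_upwards [R.coeFn_indicator hA, Lp.coeFn_zero ℝ 1 μ, hA0] with ω h1 h2 h3
      rw [h1, h2, Set.indicator_of_notMem h3]; rfl
    change φ (R.indicator A) = 0
    rw [this, map_zero]
  refine ⟨(R.signedMeasure φ).rnDeriv μ, SignedMeasure.measurable_rnDeriv _ _,
    SignedMeasure.integrable_rnDeriv _ _, fun A hA => ?_⟩
  have h := (SignedMeasure.absolutelyContinuous_iff_withDensityᵥ_rnDeriv_eq _ μ).1 hac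
  rw [← withDensityᵥ_apply (SignedMeasure.integrable_rnDeriv _ _) hA, h]
  rfl

theorem apply_simpleFunc {φ : StrongDual ℝ X} {g : Ω → ℝ} (hg : Integrable g μ)
    (h : ∀ A, MeasurableSet A → φ (R.indicator A) = ∫ ω in A, g ω ∂μ) (s : SimpleFunc Ω ℝ) :
    Integrable (fun ω => g ω * s ω) μ ∧
      ∀ x : X, R.toLp x =ᵐ[μ] s → φ x = ∫ ω, g ω * s ω ∂μ := by
  classical
  induction s using SimpleFunc.induction with
  | const c hs =>
    rename_i A
    have he : ∀ ω, g ω * (SimpleFunc.piecewise A hs (SimpleFunc.const Ω c)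
        (SimpleFunc.const Ω 0)) ω = A.indicator (fun ω => c * g ω) ω := fun ω => by
      by_cases hω : ω ∈ A <;> simp [hω, mul_comm]
    simp only [he]
    refine ⟨(hg.const_mul c).indicator hs, fun x hx => ?_⟩
    have : x = c • R.indicator A := R.ext_ae <| by
      filter_upwards [hx, R.coeFn_smul c (R.indicator A), R.coeFn_indicator hs] with ω h1 h2 h3
      rw [h1, h2, h3]
      by_cases hω : ω ∈ A <;> simp [hω]
    rw [this, map_smul, h A hs, integral_indicator hs, integral_const_mul, smul_eq_mul]
  | @add s t _ ihs iht =>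
    have he : ∀ ω, g ω * (s + t) ω = g ω * s ω + g ω * t ω := fun ω => by
      rw [SimpleFunc.add_apply, mul_add]
    simp only [he]
    refine ⟨ihs.1.add iht.1, fun x hx => ?_⟩
    obtain ⟨y, hy, -⟩ := R.exists_simpleFunc s
    obtain ⟨z, hz, -⟩ := R.exists_simpleFunc t
    have : x = y + z := R.ext_ae <| by
      filter_upwards [hx, R.coeFn_add y z, hy, hz] with ω h1 h2 h3 h4
      rw [h1, h2, h3, h4]; rfl
    rw [this, map_add, ihs.2 y hy, iht.2 z hz, integral_add ihs.1 iht.1]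

/-- Every functional on a uniformly convex function lattice is integration against a measurable
function. -/
theorem exists_represents [CompleteSpace X] [UniformConvexSpace X] (φ : StrongDual ℝ X) :
    ∃ g : Ω → ℝ, R.Represents g φ := by
  obtain ⟨g, hgm, hgi, hg⟩ := R.exists_density_indicator φ
  have hs := R.apply_simpleFunc hgi hg
  have hpos : ∀ y : X, (∀ᵐ ω ∂μ, 0 ≤ R.toLp y ω) →
      Integrable (fun ω => g ω * R.toLp y ω) μ ∧ φ y = ∫ ω, g ω * R.toLp y ω ∂μ := by
    intro y hy
    obtain ⟨s, x, hsm, hs0, hsle, hst, hx, hxt⟩ := R.exists_simpleFunc_tendsto hy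
    have hbound : ∀ n, ∫ ω, |g ω| * s n ω ∂μ ≤ ‖φ‖ * ‖y‖ := by
      intro n
      have hA : MeasurableSet {ω | 0 ≤ g ω} := measurableSet_le measurable_const hgm
      -- The test function `sign g · s n`: it gives `∫ |g| s n ≤ ‖φ‖ ‖y‖` uniformly in `n`, and
      -- monotone convergence then makes `g y` integrable.
      set t : SimpleFunc Ω ℝ := SimpleFunc.piecewise _ hA (s n) (-(s n)) with ht
      have ht' : ∀ ω, g ω * t ω = |g ω| * s n ω ∧ |t ω| = s n ω := fun ω => by
        by_cases hω : 0 ≤ g ω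
        · simp [ht, hω, abs_of_nonneg, hs0 n ω]
        · have : g ω < 0 := not_le.1 hω
          simp [ht, hω, abs_of_neg this, abs_of_nonneg (hs0 n ω)]
      obtain ⟨z, hz, -⟩ := R.exists_simpleFunc t
      have h1 := (hs t).2 z hz
      simp only [fun ω => (ht' ω).1] at h1
      rw [← h1]
      refine (le_abs_self _).trans ((φ.le_opNorm z).trans ?_)
      gcongr
      refine R.norm_le_of_ae_le ?_
      filter_upwards [hz, hsle, hy] with ω h2 h3 h4
      rw [h2, (ht' ω).2, abs_of_nonneg h4]; exact h3 n
    have hint : ∀ n, Integrable (fun ω => |g ω| * s n ω) μ := fun n =>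
      (hs (s n)).1.abs.congr (Eventually.of_forall fun ω => by
        simp only [abs_mul, abs_of_nonneg (hs0 n ω)])
    have hI : Integrable (fun ω => g ω * R.toLp y ω) μ := by
      refine ⟨(hgm.mul (R.measurable_coeFn y)).aestronglyMeasurable, ?_⟩
      have hl : Tendsto (fun n => ∫⁻ ω, ENNReal.ofReal (|g ω| * s n ω) ∂μ) atTop
          (𝓝 (∫⁻ ω, ‖g ω * R.toLp y ω‖ₑ ∂μ)) := by
        refine lintegral_tendsto_of_tendsto_of_monotone
          (fun n => (hgm.abs.mul (s n).measurable).ennreal_ofReal.aemeasurable)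
          (Eventually.of_forall fun ω n m hnm => ?_) ?_
        · exact ENNReal.ofReal_le_ofReal (mul_le_mul_of_nonneg_left (hsm ω hnm) (abs_nonneg _))
        · filter_upwards [hst, hy] with ω h1 h2
          rw [← ofReal_norm, Real.norm_eq_abs, abs_mul, abs_of_nonneg h2]
          exact ENNReal.tendsto_ofReal (h1.const_mul _)
      refine (le_of_tendsto' hl fun n => ?_).trans_lt
        (ENNReal.ofReal_lt_top (r := ‖φ‖ * ‖y‖))
      rw [← ofReal_integral_eq_lintegral_ofReal (hint n) (Eventually.of_forall fun ω =>
        mul_nonneg (abs_nonneg _) (hs0 n ω))]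
      exact ENNReal.ofReal_le_ofReal (hbound n)
    refine ⟨hI, ?_⟩
    refine tendsto_nhds_unique ((φ.continuous.tendsto y).comp hxt) ?_
    have : (φ ∘ x) = fun n => ∫ ω, g ω * s n ω ∂μ := funext fun n => (hs (s n)).2 _ (hx n)
    rw [this]
    refine tendsto_integral_of_dominated_convergence _
      (fun n => (hs (s n)).1.aestronglyMeasurable) hI.abs (fun n => ?_) ?_
    · filter_upwards [hsle, hy] with ω h1 h2
      rw [Real.norm_eq_abs, abs_mul, abs_mul, abs_of_nonneg h2, abs_of_nonneg (hs0 n ω)]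
      exact mul_le_mul_of_nonneg_left (h1 n) (abs_nonneg _)
    · exact hst.mono fun ω h => h.const_mul _
  refine ⟨g, hgm.aestronglyMeasurable, fun y => ?_⟩
  obtain ⟨p, hp⟩ := R.exists_of_ae_le y (f := fun ω => max (R.toLp y ω) 0)
    ((R.measurable_coeFn y).max measurable_const).aestronglyMeasurable
    (Eventually.of_forall fun ω => by
      rcases le_total (R.toLp y ω) 0 with h | h <;> simp [h])
  have hq : R.toLp (p - y) =ᵐ[μ] fun ω => max (R.toLp y ω) 0 - R.toLp y ω := by
    filter_upwards [R.coeFn_sub p y, hp] with ω h1 h2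
    rw [h1, h2]
  obtain ⟨h1, h2⟩ := hpos p (hp.mono fun ω h => h ▸ le_max_right _ _)
  obtain ⟨h3, h4⟩ := hpos (p - y) (hq.mono fun ω h => h ▸ sub_nonneg.2 (le_max_left _ _))
  have he : (fun ω => g ω * R.toLp p ω - g ω * R.toLp (p - y) ω) =ᵐ[μ]
      fun ω => g ω * R.toLp y ω := by
    filter_upwards [hp, hq] with ω h5 h6
    rw [h5, h6]; ring
  refine ⟨(h1.sub h3).congr he, ?_⟩
  rw [← integral_congr_ae he, integral_sub h1 h3, ← h2, ← h4, ← map_sub, sub_sub_cancel]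

end Representation

end FunctionLattice

/-! ### Supporting functionals and the modulus of smoothness. -/

section Smoothness

variable {X : Type v} [NormedAddCommGroup X] [NormedSpace ℝ X]

theorem le_smoothnessModulus {x y : X} (hx : ‖x‖ = 1) (hy : ‖y‖ = 1) (τ : ℝ) :
    (‖x + τ • y‖ + ‖x - τ • y‖) / 2 - 1 ≤ smoothnessModulus X τ := by
  refine le_csSup ⟨|τ|, ?_⟩ ⟨x, y, hx, hy, rfl⟩
  rintro _ ⟨x, y, hx, hy, rfl⟩
  have h1 := norm_add_le x (τ • y)
  have h2 := norm_sub_le x (τ • y)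
  rw [norm_smul, hx, hy, Real.norm_eq_abs] at h1 h2
  linarith

theorem smoothnessModulus_nonneg {x : X} (hx : ‖x‖ = 1) (τ : ℝ) : 0 ≤ smoothnessModulus X τ := by
  refine le_trans ?_ (le_smoothnessModulus hx hx τ)
  have h : ‖(2 : ℝ) • x‖ ≤ ‖x + τ • x‖ + ‖x - τ • x‖ := by
    refine le_of_eq_of_le ?_ (norm_add_le _ _)
    congr 1; module
  rw [norm_smul, hx, Real.norm_of_nonneg (by norm_num)] at h
  linarith

/-- For a unit vector `z`, `φ(x + τ z) + ψ(x - τ z) ≤ ‖x + τ z‖ + ‖x - τ z‖ ≤ 2 + 2 ρ(τ)`. The left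
side equals `1 + ψ(x) + τ (φ - ψ)(z)`, and `ψ(x) ≥ 1 - ‖x - y‖`. Dividing by `τ → 0` when `x = y`
gives uniqueness. -/
theorem IsSupportingFunctional.norm_sub_mul_le {φ ψ : StrongDual ℝ X} {x y : X}
    (hφ : IsSupportingFunctional φ x) (hψ : IsSupportingFunctional ψ y) (hx : ‖x‖ = 1)
    {τ : ℝ} (hτ : 0 < τ) :
    ‖φ - ψ‖ * τ ≤ 2 * smoothnessModulus X τ + ‖x - y‖ := by
  have key : ∀ z : X, ‖z‖ = 1 →
      (φ - ψ) z ≤ (2 * smoothnessModulus X τ + ‖x - y‖) / τ := fun z hz => by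
    rw [le_div_iff₀ hτ, sub_apply]
    have h1 := le_smoothnessModulus hx hz τ
    have h2 := (le_abs_self _).trans (φ.le_opNorm (x + τ • z))
    have h3 := (le_abs_self _).trans (ψ.le_opNorm (x - τ • z))
    have h4 := (le_abs_self _).trans (ψ.le_opNorm (y - x))
    rw [hφ.1, map_add, map_smul, hφ.2, smul_eq_mul] at h2
    rw [hψ.1, map_sub, map_smul, smul_eq_mul] at h3
    rw [hψ.1, map_sub, hψ.2, norm_sub_rev] at h4
    linarith
  rw [← le_div_iff₀ hτ]
  refine ContinuousLinearMap.opNorm_le_of_unit_norm ?_ fun z hz => ?_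
  · have := smoothnessModulus_nonneg hx τ
    positivity
  · rw [Real.norm_eq_abs, abs_le']
    refine ⟨key z hz, ?_⟩
    have := key (-z) (by rwa [norm_neg])
    rwa [map_neg] at this

theorem IsUniformlySmooth.eq_of_isSupportingFunctional (h : IsUniformlySmooth X)
    {φ ψ : StrongDual ℝ X} {x : X} (hφ : IsSupportingFunctional φ x)
    (hψ : IsSupportingFunctional ψ x) (hx : ‖x‖ = 1) : φ = ψ := by
  rw [← sub_eq_zero, ← norm_le_zero_iff]
  have h2 : Tendsto (fun τ : ℝ => 2 * (smoothnessModulus X τ / τ)) (𝓝[>] 0) (𝓝 0) := by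
    simpa using Tendsto.const_mul 2 h
  refine ge_of_tendsto h2 ?_
  filter_upwards [self_mem_nhdsWithin] with τ hτ
  have := hφ.norm_sub_mul_le hψ hx hτ
  rw [sub_self, norm_zero, add_zero, ← le_div_iff₀ hτ] at this
  rwa [← mul_div_assoc]

theorem exists_isSupportingFunctional {x : X} (hx : ‖x‖ = 1) :
    ∃ φ : StrongDual ℝ X, IsSupportingFunctional φ x := by
  obtain ⟨φ, h1, h2⟩ := exists_dual_vector ℝ x (by rw [hx]; exact one_ne_zero)
  exact ⟨φ, h1, by rw [h2, hx]; rfl⟩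

/-- A continuous majorant, vanishing at `0`, of `d ↦ inf_τ (2 ρ(τ) + d) / τ`. -/
theorem exists_continuous_modulus {ρ : ℝ → ℝ} (h0 : ∀ τ, 0 ≤ ρ τ)
    (h : Tendsto (fun τ : ℝ => ρ τ / τ) (𝓝[>] 0) (𝓝 0)) :
    ∃ m : ℝ≥0 → ℝ≥0, Continuous m ∧ m 0 = 0 ∧
      ∀ (d : ℝ≥0) (v : ℝ), (∀ τ > 0, v * τ ≤ 2 * ρ τ + d) → v ≤ m d := by
  have hne : Nonempty (Set.Ioi (0 : ℝ)) := ⟨⟨1, Set.mem_Ioi.2 one_pos⟩⟩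
  set f : ℝ≥0 → ℝ := fun d => ⨅ τ : Set.Ioi (0 : ℝ), (2 * ρ τ + d) / τ with hf
  have hterm : ∀ (d : ℝ≥0) (τ : Set.Ioi (0 : ℝ)), 0 ≤ (2 * ρ τ + d) / τ := fun d τ =>
    div_nonneg (by have := h0 τ; positivity) (le_of_lt τ.2)
  have hle : ∀ (d : ℝ≥0) (τ : ℝ), 0 < τ → f d ≤ (2 * ρ τ + d) / τ := fun d τ hτ =>
    ciInf_le ⟨0, by rintro _ ⟨τ, rfl⟩; exact hterm d τ⟩ (⟨τ, hτ⟩ : Set.Ioi (0 : ℝ))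
  have hf0 : ∀ d, 0 ≤ f d := fun d => le_ciInf (hterm d)
  have hmono : Monotone f := fun s t hst => le_ciInf fun τ => (hle s τ τ.2).trans (by
    have : (0 : ℝ) < τ := τ.2
    have : (s : ℝ) ≤ t := hst
    gcongr)
  -- As an infimum of affine functions of `d` with nonnegative constant terms, `f` lies above its
  -- chords from the origin; this yields subadditivity.
  have hscale : ∀ s t : ℝ≥0, 0 < s + t → (s : ℝ) / (s + t) * f (s + t) ≤ f s := by
    intro s t hst
    have hst' : (0 : ℝ) < s + t := by exact_mod_cast hst
    refine le_ciInf fun τ => ?_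
    have hτ : (0 : ℝ) < τ := τ.2
    have h1 : (s : ℝ) / (s + t) ≤ 1 := (div_le_one hst').2 (by simp)
    calc (s : ℝ) / (s + t) * f (s + t)
        ≤ (s : ℝ) / (s + t) * ((2 * ρ τ + (s + t : ℝ≥0)) / τ) := by
          gcongr; exact hle _ _ hτ
      _ = ((s : ℝ) / (s + t) * (2 * ρ τ) + s) / τ := by push_cast; field_simp
      _ ≤ (2 * ρ τ + s) / τ := by
          refine div_le_div_of_nonneg_right (add_le_add_left ?_ _) hτ.le
          exact mul_le_of_le_one_left (mul_nonneg two_pos.le (h0 τ)) h1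
  have hsub : ∀ s t : ℝ≥0, f (s + t) ≤ f s + f t := by
    intro s t
    rcases (zero_le : 0 ≤ s + t).eq_or_lt with h | h
    · rw [← h]
      rcases add_eq_zero.1 h.symm with ⟨rfl, rfl⟩
      linarith [hf0 0]
    · have h1 := hscale s t h
      have h2 := hscale t s (by rwa [add_comm])
      have h3 : (0 : ℝ) < s + t := by exact_mod_cast h
      rw [add_comm t s] at h2
      have h4 : (s : ℝ) / (s + t) * f (s + t) + (t : ℝ) / (t + s) * f (s + t) = f (s + t) := by
        rw [add_comm (t : ℝ)]; field_simp
      linarith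
  have hsmall : ∀ ε > 0, ∃ δ > 0, ∀ d : ℝ≥0, (d : ℝ) < δ → f d < ε := by
    intro ε hε
    obtain ⟨τ, h1, h2⟩ := ((h.eventually (gt_mem_nhds (show (0 : ℝ) < ε / 4 by positivity))).and
      self_mem_nhdsWithin).exists
    have hτ : (0 : ℝ) < τ := h2
    refine ⟨ε / 2 * τ, by positivity, fun d hd => (hle d τ hτ).trans_lt ?_⟩
    rw [div_lt_iff₀ hτ] at h1 ⊢
    linarith
  have hf00 : f 0 = 0 := le_antisymm (le_of_forall_pos_le_add fun ε hε => by
    obtain ⟨δ, hδ, h1⟩ := hsmall ε hε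
    have := h1 0 (by simpa using hδ)
    linarith) (hf0 0)
  refine ⟨fun d => ⟨f d, hf0 d⟩, ?_, by ext; exact hf00, fun d v hv => ?_⟩
  -- For a monotone subadditive function, continuity at `0` with value `0` implies uniform
  -- continuity.
  · refine Continuous.subtype_mk (Metric.continuous_iff.2 fun b ε hε => ?_) _
    obtain ⟨δ, hδ, h1⟩ := hsmall ε hε
    have key : ∀ s t : ℝ≥0, s ≤ t → dist s t < δ → |f s - f t| < ε := by
      intro s t hst hd
      have h2 := h1 (t - s) (by
        rwa [NNReal.dist_eq, abs_sub_comm, ← NNReal.coe_sub hst, abs_of_nonneg (NNReal.coe_nonneg _)]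
          at hd)
      have h3 := hsub s (t - s)
      rw [add_tsub_cancel_of_le hst] at h3
      rw [abs_lt]
      constructor <;> linarith [hmono hst]
    refine ⟨δ, hδ, fun a ha => ?_⟩
    rw [Real.dist_eq]
    rcases le_total a b with hab | hab
    · exact key a b hab ha
    · rw [abs_sub_comm]; exact key b a hab (by rwa [dist_comm])
  · exact le_ciInf fun τ => (le_div_iff₀ τ.2).2 (hv τ τ.2)

end Smoothness

/-! ### The polar `|g| x` and uniform continuity in both directions. -/

namespace FunctionLattice

section Polar

variable {Ω : Type u} [MeasurableSpace Ω] {μ : Measure Ω}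
  {X : Type v} [NormedAddCommGroup X] [NormedSpace ℝ X] (R : FunctionLattice μ X)

/-- Changing the sign of `y` where `g y < 0` does not change `|y|`, hence not the lattice norm. The
measurable version `g'` serves to make that set measurable. -/
theorem Represents.integral_abs_le {R : FunctionLattice μ X} {g : Ω → ℝ} {φ : StrongDual ℝ X}
    (h : R.Represents g φ) (y : X) : ∫ ω, |g ω * R.toLp y ω| ∂μ ≤ ‖φ‖ * ‖y‖ := by
  set g' := h.1.mk g
  have hgm : Measurable g' := h.1.stronglyMeasurable_mk.measurable
  have hA : MeasurableSet {ω | 0 ≤ g' ω * R.toLp y ω} :=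
    measurableSet_le measurable_const (hgm.mul (R.measurable_coeFn y))
  classical
  obtain ⟨z, hz⟩ := R.exists_of_ae_le y
    (f := {ω | 0 ≤ g' ω * R.toLp y ω}.piecewise (R.toLp y) (fun ω => -R.toLp y ω))
    ((R.measurable_coeFn y).piecewise hA (R.measurable_coeFn y).neg).aestronglyMeasurable
    (Eventually.of_forall fun ω => by
      by_cases hω : 0 ≤ g' ω * R.toLp y ω <;> simp [hω])
  have h1 : ∀ᵐ ω ∂μ, |g ω * R.toLp y ω| = g ω * R.toLp z ω := by
    filter_upwards [hz, h.1.ae_eq_mk] with ω h1 h2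
    rw [h1, h2]
    by_cases hω : 0 ≤ g' ω * R.toLp y ω
    · simp [hω, abs_of_nonneg, g']
    · rw [Set.piecewise_eq_of_notMem _ _ _ (by exact hω), abs_of_neg (not_le.1 hω), mul_neg]
  rw [integral_congr_ae h1, ← (h.2 z).2]
  refine (le_abs_self _).trans ((φ.le_opNorm z).trans ?_)
  gcongr
  refine R.norm_le_of_ae_le (hz.mono fun ω h1 => ?_)
  rw [h1]
  by_cases hω : 0 ≤ g' ω * R.toLp y ω <;> simp [hω]

theorem Represents.sub {R : FunctionLattice μ X} {g₁ g₂ : Ω → ℝ} {φ₁ φ₂ : StrongDual ℝ X}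
    (h₁ : R.Represents g₁ φ₁) (h₂ : R.Represents g₂ φ₂) :
    R.Represents (fun ω => g₁ ω - g₂ ω) (φ₁ - φ₂) := by
  refine ⟨h₁.1.sub h₂.1, fun y => ?_⟩
  simp only [sub_mul]
  refine ⟨(h₁.2 y).1.sub (h₂.2 y).1, ?_⟩
  rw [integral_sub (h₁.2 y).1 (h₂.2 y).1, ← (h₁.2 y).2, ← (h₂.2 y).2]; rfl

/-- The function `g` is (up to sign) a supporting functional of the unit vector `x`. -/
structure IsPolar (g : Ω → ℝ) (x : X) : Prop where
  norm_eq : ‖x‖ = 1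
  aestronglyMeasurable : AEStronglyMeasurable g μ
  integrable_mul : ∀ y : X, Integrable (fun ω => g ω * R.toLp y ω) μ
  integral_le : ∀ y : X, ∫ ω, |g ω * R.toLp y ω| ∂μ ≤ ‖y‖
  integral_eq : ∫ ω, |g ω * R.toLp x ω| ∂μ = 1

theorem Represents.isPolar {R : FunctionLattice μ X} {g : Ω → ℝ} {φ : StrongDual ℝ X} {x : X}
    (h : R.Represents g φ) (hφ : IsSupportingFunctional φ x) (hx : ‖x‖ = 1) : R.IsPolar g x where
  norm_eq := hx
  aestronglyMeasurable := h.1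
  integrable_mul y := (h.2 y).1
  integral_le y := by simpa [hφ.1] using h.integral_abs_le y
  integral_eq := by
    refine le_antisymm (by simpa [hφ.1, hx] using h.integral_abs_le x) ?_
    rw [← hφ.2, (h.2 x).2]
    exact integral_mono (h.2 x).1 (h.2 x).1.abs fun ω => le_abs_self _

variable {R} {g g₁ g₂ : Ω → ℝ} {x x₁ x₂ : X}

theorem IsPolar.integrable_abs_mul (h : R.IsPolar g x) (y : X) :
    Integrable (fun ω => |g ω| * R.toLp y ω) μ := by
  refine (h.integrable_mul y).mono
    (h.aestronglyMeasurable.norm.mul (R.measurable_coeFn y).aestronglyMeasurable) ?_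
  exact Eventually.of_forall fun ω => by simp

theorem IsPolar.integral_mul_le (h : R.IsPolar g x) (y : X) :
    ∫ ω, |g ω| * R.toLp y ω ∂μ ≤ ‖y‖ := by
  refine (integral_mono (h.integrable_abs_mul y) (h.integrable_mul y).abs fun ω => ?_).trans
    (h.integral_le y)
  rw [abs_mul]
  exact mul_le_mul_of_nonneg_left (le_abs_self _) (abs_nonneg _)

/-- Split `|g₁| x₁ - |g₂| x₂ = (|g₁| - |g₂|) x₁ + |g₂| (x₁ - x₂)`. -/
theorem integral_polar_sub_le {φ₁ φ₂ : StrongDual ℝ X} (h₁ : R.Represents g₁ φ₁)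
    (h₂ : R.Represents g₂ φ₂) (x₁ x₂ : X) :
    ∫ ω, |(|g₁ ω| * R.toLp x₁ ω) - |g₂ ω| * R.toLp x₂ ω| ∂μ ≤
      ‖φ₁ - φ₂‖ * ‖x₁‖ + ‖φ₂‖ * ‖x₁ - x₂‖ := by
  have h := h₁.sub h₂
  have i1 := (h.2 x₁).1.abs
  have i2 := (h₂.2 (x₁ - x₂)).1.abs
  refine le_trans ?_ (add_le_add (h.integral_abs_le x₁) (h₂.integral_abs_le (x₁ - x₂)))
  rw [← integral_add i1 i2]
  refine integral_mono_of_nonneg (Eventually.of_forall fun ω => abs_nonneg _) (i1.add i2) ?_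
  filter_upwards [R.coeFn_sub x₁ x₂] with ω h3
  rw [h3, abs_mul, abs_mul]
  calc |(|g₁ ω| * R.toLp x₁ ω) - |g₂ ω| * R.toLp x₂ ω|
      = |(|g₁ ω| - |g₂ ω|) * R.toLp x₁ ω + |g₂ ω| * (R.toLp x₁ ω - R.toLp x₂ ω)| := by
        congr 1; ring
    _ ≤ |(|g₁ ω| - |g₂ ω|) * R.toLp x₁ ω| + |(|g₂ ω| * (R.toLp x₁ ω - R.toLp x₂ ω))| :=
        abs_add_le _ _
    _ ≤ _ := by
        rw [abs_mul, abs_mul, abs_abs]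
        exact add_le_add_left (mul_le_mul_of_nonneg_right
          (abs_abs_sub_abs_le_abs_sub (g₁ ω) (g₂ ω)) (abs_nonneg _)) _

/-- If `a₁ b₁ ≥ a₂ b₂` are products of nonnegative numbers, then `a₁ b₂ + a₂ b₁ ≥ 2 a₂ b₂`. -/
theorem two_mul_le_of_mul_le_mul {a₁ a₂ b₁ b₂ : ℝ} (ha₁ : 0 ≤ a₁) (ha₂ : 0 ≤ a₂) (hb₁ : 0 ≤ b₁)
    (hb₂ : 0 ≤ b₂) (h : a₂ * b₂ ≤ a₁ * b₁) : 2 * (a₂ * b₂) ≤ a₁ * b₂ + a₂ * b₁ := by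
  -- `(a₁ b₂ + a₂ b₁)² ≥ 4 (a₁ b₁) (a₂ b₂) ≥ 4 (a₂ b₂)²`.
  refine abs_le_of_sq_le_sq' ?_ (by positivity) |>.2
  nlinarith [sq_nonneg (a₁ * b₂ - a₂ * b₁), mul_nonneg ha₂ hb₂]

theorem mul_add_mul_le_add_abs {a₁ a₂ b₁ b₂ : ℝ} (ha₁ : 0 ≤ a₁) (ha₂ : 0 ≤ a₂) (hb₁ : 0 ≤ b₁)
    (hb₂ : 0 ≤ b₂) :
    a₁ * b₁ + a₂ * b₂ ≤ a₁ * b₂ + a₂ * b₁ + |a₁ * b₁ - a₂ * b₂| := by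
  rcases le_total (a₂ * b₂) (a₁ * b₁) with h | h
  · have := two_mul_le_of_mul_le_mul ha₁ ha₂ hb₁ hb₂ h
    have := le_abs_self (a₁ * b₁ - a₂ * b₂)
    linarith
  · have := two_mul_le_of_mul_le_mul ha₂ ha₁ hb₂ hb₁ h
    have := neg_le_abs (a₁ * b₁ - a₂ * b₂)
    linarith

/-- Test `|g₁|` and `|g₂|` on `|x₁| + |x₂|`. The diagonal terms contribute `2`, and by
`mul_add_mul_le_add_abs` the cross terms contribute at least `2` minus the `L₁` distance of the
polars. -/
theorem IsPolar.le_norm_add_abs (h₁ : R.IsPolar g₁ x₁) (h₂ : R.IsPolar g₂ x₂) {a₁ a₂ : X}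
    (ha₁ : R.toLp a₁ =ᵐ[μ] fun ω => |R.toLp x₁ ω|) (ha₂ : R.toLp a₂ =ᵐ[μ] fun ω => |R.toLp x₂ ω|) :
    2 - (∫ ω, |(|g₁ ω| * R.toLp x₁ ω) - |g₂ ω| * R.toLp x₂ ω| ∂μ) / 2 ≤ ‖a₁ + a₂‖ := by
  have e1 := h₁.integral_mul_le (a₁ + a₂)
  have e2 := h₂.integral_mul_le (a₁ + a₂)
  have i1 := h₁.integrable_abs_mul (a₁ + a₂)
  have i2 := h₂.integrable_abs_mul (a₁ + a₂)
  have j1 := (h₁.integrable_mul x₁).abs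
  have j2 := (h₂.integrable_mul x₂).abs
  have j3 := ((h₁.integrable_abs_mul x₁).sub (h₂.integrable_abs_mul x₂)).abs
  simp only [Pi.sub_apply] at j3
  have key : ∫ ω, (2 * |g₁ ω * R.toLp x₁ ω| + 2 * |g₂ ω * R.toLp x₂ ω|) ∂μ ≤
      ∫ ω, (|g₁ ω| * R.toLp (a₁ + a₂) ω + |g₂ ω| * R.toLp (a₁ + a₂) ω +
        |(|g₁ ω| * R.toLp x₁ ω) - |g₂ ω| * R.toLp x₂ ω|) ∂μ := by
    refine integral_mono_ae ((j1.const_mul 2).add (j2.const_mul 2)) ((i1.add i2).add j3) ?_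
    filter_upwards [R.coeFn_add a₁ a₂, ha₁, ha₂] with ω h3 h4 h5
    rw [h3, h4, h5, abs_mul, abs_mul]
    have h6 := mul_add_mul_le_add_abs (abs_nonneg (g₁ ω)) (abs_nonneg (g₂ ω))
      (abs_nonneg (R.toLp x₁ ω)) (abs_nonneg (R.toLp x₂ ω))
    have h7 := abs_abs_sub_abs_le_abs_sub (|g₁ ω| * R.toLp x₁ ω) (|g₂ ω| * R.toLp x₂ ω)
    rw [abs_mul, abs_mul, abs_abs, abs_abs] at h7
    linarith
  rw [integral_add (j1.const_mul 2) (j2.const_mul 2), integral_const_mul, integral_const_mul,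
    h₁.integral_eq, h₂.integral_eq, integral_add (by exact i1.add i2) j3,
    integral_add i1 i2] at key
  linarith

/-- Restricting `|x|` to a set where the polar `|g| x` has small mass changes it little. -/
theorem IsPolar.le_norm_abs_add_restrict (h : R.IsPolar g x) {A : Set Ω} {k : Ω → ℝ}
    (hk : Integrable k μ) (hA : ∀ᵐ ω ∂μ, ω ∈ A → |g ω * R.toLp x ω| ≤ k ω)
    (hk0 : ∀ ω, 0 ≤ k ω) {a w : X}
    (ha : R.toLp a =ᵐ[μ] fun ω => |R.toLp x ω|)
    (hw : R.toLp w =ᵐ[μ] Aᶜ.indicator fun ω => |R.toLp x ω|) :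
    2 - ∫ ω, k ω ∂μ ≤ ‖a + w‖ := by
  have i1 := h.integrable_abs_mul (a + w)
  have j1 := (h.integrable_mul x).abs
  have key : ∫ ω, 2 * |g ω * R.toLp x ω| ∂μ ≤ ∫ ω, (|g ω| * R.toLp (a + w) ω + k ω) ∂μ := by
    refine integral_mono_ae (j1.const_mul 2) (i1.add hk) ?_
    filter_upwards [R.coeFn_add a w, ha, hw, hA] with ω h1 h2 h3 h4
    rw [h1, h2, h3]
    rw [abs_mul] at h4 ⊢
    by_cases hω : ω ∈ A
    · rw [Set.indicator_of_notMem (by simpa using hω)]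
      have := h4 hω
      linarith
    · rw [Set.indicator_of_mem (by simpa using hω)]
      have := hk0 ω
      linarith
  rw [integral_const_mul, h.integral_eq, integral_add i1 hk] at key
  have := h.integral_mul_le (a + w)
  linarith

variable (R)

/-- In a uniformly convex function lattice the map `|g| x ↦ x` is uniformly continuous. -/
theorem exists_norm_sub_lt_of_polar [UniformConvexSpace X] {ε : ℝ} (hε : 0 < ε) :
    ∃ δ > 0, ∀ (x₁ x₂ : X) (g₁ g₂ : Ω → ℝ), R.IsPolar g₁ x₁ → R.IsPolar g₂ x₂ →
      ∫ ω, |(|g₁ ω| * R.toLp x₁ ω) - |g₂ ω| * R.toLp x₂ ω| ∂μ < δ → ‖x₁ - x₂‖ < ε := by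
  obtain ⟨δ, hδ, hUC⟩ := exists_forall_closed_ball_dist_add_le_two_sub X
    (show 0 < ε / 3 by positivity)
  refine ⟨δ, hδ, fun x₁ x₂ g₁ g₂ h₁ h₂ hd => ?_⟩
  obtain ⟨a₁, ha₁, hna₁⟩ := R.exists_abs x₁
  obtain ⟨a₂, ha₂, hna₂⟩ := R.exists_abs x₂
  -- The moduli are compared by `le_norm_add_abs`; what remains is the set `A` of opposite signs.
  -- There the polars have opposite signs too, so their difference carries the full mass of both,
  -- and cutting `A` off changes `|x₁|` and `|x₂|` little.
  set A : Set Ω := {ω | R.toLp x₁ ω * R.toLp x₂ ω < 0} with hA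
  have hAm : MeasurableSet A :=
    measurableSet_lt ((R.measurable_coeFn x₁).mul (R.measurable_coeFn x₂)) measurable_const
  have hex : ∀ x : X, ∃ w : X, R.toLp w =ᵐ[μ] Aᶜ.indicator fun ω => |R.toLp x ω| := fun x =>
    R.exists_of_ae_le x ((R.measurable_coeFn x).abs.indicator hAm.compl).aestronglyMeasurable
      (Eventually.of_forall fun ω => by
        by_cases hω : ω ∈ A <;> simp [hω])
  have hnw : ∀ x w : X, R.toLp w =ᵐ[μ] (Aᶜ.indicator fun ω => |R.toLp x ω|) → ‖w‖ ≤ ‖x‖ :=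
    fun x w hw => R.norm_le_of_ae_le (hw.mono fun ω h => by
      rw [h]; by_cases hω : ω ∈ A <;> simp [hω])
  obtain ⟨w₁, hw₁⟩ := hex x₁
  obtain ⟨w₂, hw₂⟩ := hex x₂
  have j3 := ((h₁.integrable_abs_mul x₁).sub (h₂.integrable_abs_mul x₂)).abs
  simp only [Pi.sub_apply] at j3
  have hmass : ∀ ω ∈ A, |g₁ ω * R.toLp x₁ ω| + |g₂ ω * R.toLp x₂ ω| ≤
      |(|g₁ ω| * R.toLp x₁ ω) - |g₂ ω| * R.toLp x₂ ω| := by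
    intro ω hω
    rw [abs_mul, abs_mul]
    rcases mul_neg_iff.1 (show R.toLp x₁ ω * R.toLp x₂ ω < 0 from hω) with ⟨h3, h4⟩ | ⟨h3, h4⟩
    · rw [abs_of_pos h3, abs_of_neg h4]
      exact le_of_eq_of_le (by ring) (le_abs_self _)
    · rw [abs_of_neg h3, abs_of_pos h4]
      exact le_of_eq_of_le (by ring) (neg_le_abs _)
  have n1 := h₁.norm_eq
  have n2 := h₂.norm_eq
  have b1 : ‖a₁ - a₂‖ < ε / 3 := by
    by_contra! hcon
    have e1 := hUC (by rw [hna₁, n1]) (by rw [hna₂, n2]) hcon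
    have e2 := h₁.le_norm_add_abs h₂ ha₁ ha₂
    linarith
  have b2 : ‖a₁ - w₁‖ < ε / 3 := by
    by_contra! hcon
    have e1 := hUC (by rw [hna₁, n1]) (by rw [← n1]; exact hnw _ _ hw₁) hcon
    have e2 := h₁.le_norm_abs_add_restrict j3 (A := A) (Eventually.of_forall fun ω hω => by
      have := hmass ω hω
      have := abs_nonneg (g₂ ω * R.toLp x₂ ω)
      linarith) (fun ω => abs_nonneg _) ha₁ hw₁
    linarith
  have b3 : ‖a₂ - w₂‖ < ε / 3 := by
    by_contra! hcon
    have e1 := hUC (by rw [hna₂, n2]) (by rw [← n2]; exact hnw _ _ hw₂) hcon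
    have e2 := h₂.le_norm_abs_add_restrict j3 (A := A) (Eventually.of_forall fun ω hω => by
      have := hmass ω hω
      have := abs_nonneg (g₁ ω * R.toLp x₁ ω)
      linarith) (fun ω => abs_nonneg _) ha₂ hw₂
    linarith
  obtain ⟨b, hb, hnb⟩ := R.exists_abs (a₁ - a₂)
  -- Pointwise, `|x₁ - x₂| ≤ ||x₁| - |x₂|| + 1_A |x₁| + 1_A |x₂|`; each summand has norm below `ε /
  -- 3`.
  have : ‖x₁ - x₂‖ ≤ ‖b + (a₁ - w₁) + (a₂ - w₂)‖ := by
    refine R.norm_le_of_ae_le ?_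
    filter_upwards [R.coeFn_sub x₁ x₂, R.coeFn_add (b + (a₁ - w₁)) (a₂ - w₂),
      R.coeFn_add b (a₁ - w₁), R.coeFn_sub a₁ w₁, R.coeFn_sub a₂ w₂, hb, R.coeFn_sub a₁ a₂,
      ha₁, ha₂, hw₁, hw₂] with ω c1 c2 c3 c4 c5 c6 c7 c8 c9 c10 c11
    rw [c1, c2, c3, c4, c5, c6, c7, c8, c9, c10, c11]
    refine le_trans ?_ (le_abs_self _)
    by_cases hω : ω ∈ A
    · rw [Set.indicator_of_notMem (by simpa using hω), Set.indicator_of_notMem (by simpa using hω)]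
      have := abs_sub (R.toLp x₁ ω) (R.toLp x₂ ω)
      have := abs_nonneg (|R.toLp x₁ ω| - |R.toLp x₂ ω|)
      linarith
    · rw [Set.indicator_of_mem (by simpa using hω), Set.indicator_of_mem (by simpa using hω)]
      have h3 : 0 ≤ R.toLp x₁ ω * R.toLp x₂ ω := not_lt.1 hω
      have h4 : |R.toLp x₁ ω - R.toLp x₂ ω| = |(|R.toLp x₁ ω| - |R.toLp x₂ ω|)| := by
        rw [← sq_eq_sq_iff_abs_eq_abs, sub_sq, sub_sq, sq_abs, sq_abs, mul_assoc, mul_assoc,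
          ← abs_mul, abs_of_nonneg h3]
      linarith
  calc ‖x₁ - x₂‖ ≤ ‖b + (a₁ - w₁) + (a₂ - w₂)‖ := this
    _ ≤ ‖b‖ + ‖a₁ - w₁‖ + ‖a₂ - w₂‖ := norm_add₃_le
    _ < ε := by rw [hnb]; linarith

end Polar

end FunctionLattice

/-! ### The entropy functional and its maximizers. -/

section Entropy

variable {Ω : Type u} [MeasurableSpace Ω] {μ : Measure Ω}

/-- `h` is a function in `S(L₁(μ))` that is bounded by `C`. -/
structure IsWeight (μ : Measure Ω) (h : Ω → ℝ) (C : ℝ) : Prop where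
  measurable : Measurable h
  abs_le : ∀ᵐ ω ∂μ, |h ω| ≤ C
  integral_abs : ∫ ω, |h ω| ∂μ = 1

/-- The entropy `E(h, f)` of the nonnegative function `f` is finite. -/
structure HasEntropy (μ : Measure Ω) (h f : Ω → ℝ) : Prop where
  pos : ∀ᵐ ω ∂μ, h ω ≠ 0 → 0 < f ω
  integrable : Integrable (fun ω => |h ω| * Real.log (f ω)) μ

variable {h f k : Ω → ℝ} {C : ℝ}

theorem IsWeight.integrable (hh : IsWeight μ h C) : Integrable (fun ω => |h ω|) μ :=
  by_contra fun hn => by simpa [integral_undef hn] using hh.integral_abs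

theorem IsWeight.integrable_mul (hh : IsWeight μ h C) (hf : Integrable f μ) :
    Integrable (fun ω => |h ω| * f ω) μ :=
  hf.bdd_mul hh.measurable.abs.aestronglyMeasurable
    (hh.abs_le.mono fun ω h1 => by rwa [Real.norm_eq_abs, abs_abs])

/-- `Real.log 0 = 0` whereas `ENNReal.log 0 = ⊥`; the hypothesis keeps `b = 0` to the points where
`a = 0`. -/
theorem enorm_mul_toENNReal_log (a b : ℝ) (hab : a ≠ 0 → b ≠ 0) :
    ‖a‖ₑ * (ENNReal.log ‖b‖ₑ).toENNReal = ENNReal.ofReal (|a| * Real.log b) := by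
  by_cases ha : a = 0
  · simp [ha]
  · rw [ENNReal.log_pos_real (by simpa using hab ha) (by simp), EReal.real_coe_toENNReal,
      toReal_enorm, Real.norm_eq_abs, Real.log_abs, ENNReal.ofReal_mul (abs_nonneg _),
      Real.enorm_eq_ofReal_abs]

theorem enorm_mul_toENNReal_neg_log (a b : ℝ) (hab : a ≠ 0 → b ≠ 0) :
    ‖a‖ₑ * (-ENNReal.log ‖b‖ₑ).toENNReal = ENNReal.ofReal (-(|a| * Real.log b)) := by
  by_cases ha : a = 0
  · simp [ha]
  · rw [ENNReal.log_pos_real (by simpa using hab ha) (by simp), ← EReal.coe_neg,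
      EReal.real_coe_toENNReal, toReal_enorm, Real.norm_eq_abs, Real.log_abs, ← mul_neg,
      ENNReal.ofReal_mul (abs_nonneg _), Real.enorm_eq_ofReal_abs]

theorem HasEntropy.entropy_eq (hf : HasEntropy μ h f) :
    entropy μ h f = ((∫ ω, |h ω| * Real.log (f ω) ∂μ : ℝ) : EReal) := by
  have h1 : ∫⁻ ω, ‖h ω‖ₑ * (ENNReal.log ‖f ω‖ₑ).toENNReal ∂μ =
      ∫⁻ ω, ENNReal.ofReal (|h ω| * Real.log (f ω)) ∂μ :=
    lintegral_congr_ae (hf.pos.mono fun ω h1 =>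
      enorm_mul_toENNReal_log _ _ fun h2 => (h1 h2).ne')
  have h2 : ∫⁻ ω, ‖h ω‖ₑ * (-ENNReal.log ‖f ω‖ₑ).toENNReal ∂μ =
      ∫⁻ ω, ENNReal.ofReal (-(|h ω| * Real.log (f ω))) ∂μ :=
    lintegral_congr_ae (hf.pos.mono fun ω h1 =>
      enorm_mul_toENNReal_neg_log _ _ fun h2 => (h1 h2).ne')
  have h3 := hf.integrable.lintegral_lt_top
  have h4 := hf.integrable.neg.lintegral_lt_top
  simp only [Pi.neg_apply] at h4
  rw [entropy, h1, h2, integral_eq_lintegral_pos_part_sub_lintegral_neg_part hf.integrable,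
    EReal.coe_sub, EReal.coe_ennreal_toReal h3.ne, EReal.coe_ennreal_toReal h4.ne]

theorem IsWeight.hasEntropy_of_ne_bot (hh : IsWeight μ h C) (hfm : Measurable f)
    (hf : Integrable f μ) (hf0 : ∀ᵐ ω ∂μ, 0 ≤ f ω) (hne : entropy μ h f ≠ ⊥) :
    HasEntropy μ h f := by
  -- In `EReal`, `x - ⊤ = ⊥` even for `x = ⊤`, so a value other than `⊥` forces the negative part to
  -- be finite. The positive part is dominated by `|h| f`, since `log t ≤ t`.
  have hneg : ∫⁻ ω, ‖h ω‖ₑ * (-ENNReal.log ‖f ω‖ₑ).toENNReal ∂μ ≠ ⊤ := fun h1 => by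
    rw [entropy, h1, EReal.coe_ennreal_top, EReal.sub_top] at hne
    exact hne rfl
  have hmeas : Measurable fun ω => ‖h ω‖ₑ * (-ENNReal.log ‖f ω‖ₑ).toENNReal :=
    hh.measurable.enorm.mul (by fun_prop)
  have hpos : ∀ᵐ ω ∂μ, h ω ≠ 0 → 0 < f ω := by
    filter_upwards [ae_lt_top hmeas hneg, hf0] with ω h1 h2 h3
    refine h2.lt_of_ne fun h4 => ?_
    rw [← h4, enorm_zero, ENNReal.log_zero, EReal.neg_bot, EReal.toENNReal_top,
      ENNReal.mul_top (by simpa using h3)] at h1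
    exact h1.ne rfl
  refine ⟨hpos, ?_⟩
  have h2 : ∫⁻ ω, ‖h ω‖ₑ * (-ENNReal.log ‖f ω‖ₑ).toENNReal ∂μ =
      ∫⁻ ω, ENNReal.ofReal (-(|h ω| * Real.log (f ω))) ∂μ :=
    lintegral_congr_ae (hpos.mono fun ω h1 =>
      enorm_mul_toENNReal_neg_log _ _ fun h2 => (h1 h2).ne')
  have hi := hh.integrable_mul hf
  have hm : Measurable fun ω => |h ω| * Real.log (f ω) := hh.measurable.abs.mul hfm.log
  refine ⟨hm.aestronglyMeasurable, ?_⟩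
  calc ∫⁻ ω, ‖|h ω| * Real.log (f ω)‖ₑ ∂μ
      ≤ ∫⁻ ω, (ENNReal.ofReal (|h ω| * f ω) +
          ENNReal.ofReal (-(|h ω| * Real.log (f ω)))) ∂μ := by
        refine lintegral_mono_ae (hf0.mono fun ω h3 => ?_)
        have h4 : |h ω| * Real.log (f ω) ≤ |h ω| * f ω :=
          mul_le_mul_of_nonneg_left (Real.log_le_self h3) (abs_nonneg _)
        rw [Real.enorm_eq_ofReal_abs]
        rcases le_total 0 (|h ω| * Real.log (f ω)) with h5 | h5
        · rw [abs_of_nonneg h5]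
          exact (ENNReal.ofReal_le_ofReal h4).trans le_self_add
        · rw [abs_of_nonpos h5]
          exact le_add_self
    _ = ∫⁻ ω, ENNReal.ofReal (|h ω| * f ω) ∂μ +
          ∫⁻ ω, ENNReal.ofReal (-(|h ω| * Real.log (f ω))) ∂μ :=
        lintegral_add_right _ hm.neg.ennreal_ofReal
    _ < ⊤ := ENNReal.add_lt_top.2 ⟨hi.lintegral_lt_top, h2 ▸ hneg.lt_top⟩

/-- `log f` lies between `log c + log k` and `f`. -/
theorem HasEntropy.of_mul_le (hk : HasEntropy μ h k) (hh : IsWeight μ h C) (hfm : Measurable f)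
    (hf : Integrable f μ) {c : ℝ} (hc : 0 < c) (hle : ∀ᵐ ω ∂μ, c * k ω ≤ f ω) :
    HasEntropy μ h f := by
  have hpos : ∀ᵐ ω ∂μ, h ω ≠ 0 → 0 < f ω := by
    filter_upwards [hk.pos, hle] with ω h1 h2 h3
    exact (mul_pos hc (h1 h3)).trans_le h2
  refine ⟨hpos, (((hk.integrable.abs.add (hh.integrable.const_mul |Real.log c|)).add
    (hh.integrable_mul hf).abs).mono
      (hh.measurable.abs.mul hfm.log).aestronglyMeasurable ?_)⟩
  filter_upwards [hk.pos, hle, hpos] with ω h1 h2 h3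
  rw [Real.norm_eq_abs]
  refine le_trans ?_ (le_abs_self _)
  simp only [Pi.add_apply]
  by_cases h0 : h ω = 0
  · simp [h0]
  have h4 := Real.log_le_log (mul_pos hc (h1 h0)) h2
  rw [Real.log_mul hc.ne' (h1 h0).ne'] at h4
  have h5 := Real.log_le_self (h3 h0).le
  rw [abs_mul, abs_mul, abs_mul, abs_abs, mul_comm |Real.log c|, ← mul_add, ← mul_add]
  refine mul_le_mul_of_nonneg_left (abs_le.2 ⟨?_, ?_⟩) (abs_nonneg _)
  · linarith [neg_abs_le (Real.log c), neg_abs_le (Real.log (k ω)), abs_nonneg (f ω)]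
  · linarith [abs_nonneg (Real.log c), abs_nonneg (Real.log (k ω)), le_abs_self (f ω)]

theorem IsWeight.not_ae_eq_zero (hh : IsWeight μ h C) : ¬ ∀ᵐ ω ∂μ, h ω = 0 := fun h0 => by
  have := hh.integral_abs
  rw [integral_congr_ae (g := fun _ => (0 : ℝ)) (h0.mono fun ω h1 => by simp [h1])] at this
  simp at this

theorem log_add_log_le {a b : ℝ} (ha : 0 < a) (hb : 0 < b) :
    (Real.log a + Real.log b) / 2 ≤ Real.log ((1 / 2) * (a + b)) := by
  have h1 : Real.log (a * b) ≤ Real.log (((1 / 2) * (a + b)) ^ 2) :=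
    Real.log_le_log (by positivity) (by nlinarith [sq_nonneg (a - b)])
  rw [Real.log_mul ha.ne' hb.ne', Real.log_pow] at h1
  push_cast at h1
  linarith

namespace FunctionLattice

variable {X : Type v} [NormedAddCommGroup X] [NormedSpace ℝ X] (R : FunctionLattice μ X)

/-- `M` bounds the entropy `E(h, ·)` on the positive part of the unit ball of `X`. -/
def EntropyBound (h : Ω → ℝ) (M : ℝ) : Prop :=
  ∀ k : X, (∀ᵐ ω ∂μ, 0 ≤ R.toLp k ω) → ‖k‖ ≤ 1 → HasEntropy μ h (R.toLp k) →
    ∫ ω, |h ω| * Real.log (R.toLp k ω) ∂μ ≤ M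

variable {R} {M : ℝ} {x y : X}

theorem ne_zero_of_hasEntropy (hh : IsWeight μ h C) (hx : HasEntropy μ h (R.toLp x)) : x ≠ 0 := by
  rintro rfl
  refine hh.not_ae_eq_zero ?_
  have h0 : R.toLp (0 : X) =ᵐ[μ] 0 := by rw [map_zero]; exact Lp.coeFn_zero ℝ 1 μ
  filter_upwards [hx.pos, h0] with ω h1 h2
  by_contra h3
  have := h1 h3
  rw [h2] at this
  exact lt_irrefl _ this

theorem hasEntropy_smul (hh : IsWeight μ h C) (hx : HasEntropy μ h (R.toLp x)) {c : ℝ}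
    (hc : 0 < c) : HasEntropy μ h (R.toLp (c • x)) ∧
      ∫ ω, |h ω| * Real.log (R.toLp (c • x) ω) ∂μ =
        ∫ ω, |h ω| * Real.log (R.toLp x ω) ∂μ + Real.log c := by
  refine ⟨hx.of_mul_le hh (R.measurable_coeFn _) (R.integrable_coeFn _) hc
    ((R.coeFn_smul c x).mono fun ω h1 => h1.ge), ?_⟩
  have : ∀ᵐ ω ∂μ, |h ω| * Real.log (R.toLp (c • x) ω) =
      |h ω| * Real.log (R.toLp x ω) + |h ω| * Real.log c := by
    filter_upwards [R.coeFn_smul c x, hx.pos] with ω h1 h2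
    by_cases h0 : h ω = 0
    · simp [h0]
    · rw [h1, Real.log_mul hc.ne' (h2 h0).ne']; ring
  rw [integral_congr_ae this, integral_add hx.integrable (hh.integrable.mul_const _),
    integral_mul_const, hh.integral_abs, one_mul]

/-- Since `∫ |h| = 1`, scaling by `c` adds `log c` to the entropy, so the bound on the unit ball
extends to all positive elements. -/
theorem EntropyBound.le_add_log (hM : R.EntropyBound h M) (hh : IsWeight μ h C)
    (hx : HasEntropy μ h (R.toLp x)) (hx0 : ∀ᵐ ω ∂μ, 0 ≤ R.toLp x ω) :
    ∫ ω, |h ω| * Real.log (R.toLp x ω) ∂μ ≤ M + Real.log ‖x‖ := by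
  have hn : 0 < ‖x‖ := norm_pos_iff.2 (ne_zero_of_hasEntropy hh hx)
  obtain ⟨h1, h2⟩ := hasEntropy_smul hh hx (inv_pos.2 hn)
  have h3 := hM (‖x‖⁻¹ • x)
    (by filter_upwards [R.coeFn_smul ‖x‖⁻¹ x, hx0] with ω h3 h4
        rw [h3]; positivity)
    (by rw [norm_smul, norm_inv, norm_norm, inv_mul_cancel₀ hn.ne']) h1
  rw [h2, Real.log_inv] at h3
  linarith

/-- Concavity of `log` gives the midpoint `z` entropy at least `M - δ`, and `le_add_log` bounds it
by `M + log ‖z‖ ≤ M + ‖z‖ - 1`. With uniform convexity this yields both existence and uniqueness of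
maximizers. -/
theorem EntropyBound.le_norm_add (hM : R.EntropyBound h M) (hh : IsWeight μ h C)
    (hx : HasEntropy μ h (R.toLp x)) (hx0 : ∀ᵐ ω ∂μ, 0 ≤ R.toLp x ω)
    (hy : HasEntropy μ h (R.toLp y)) (hy0 : ∀ᵐ ω ∂μ, 0 ≤ R.toLp y ω) {δ : ℝ}
    (hxM : M - δ ≤ ∫ ω, |h ω| * Real.log (R.toLp x ω) ∂μ)
    (hyM : M - δ ≤ ∫ ω, |h ω| * Real.log (R.toLp y ω) ∂μ) :
    2 - 2 * δ ≤ ‖x + y‖ := by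
  set z : X := (1 / 2 : ℝ) • (x + y) with hz
  have hzc : R.toLp z =ᵐ[μ] fun ω => (1 / 2) * (R.toLp x ω + R.toLp y ω) := by
    filter_upwards [R.coeFn_smul (1 / 2) (x + y), R.coeFn_add x y] with ω h1 h2
    rw [hz, h1, h2]
  have hze : HasEntropy μ h (R.toLp z) := by
    refine hx.of_mul_le hh (R.measurable_coeFn _) (R.integrable_coeFn _) one_half_pos ?_
    filter_upwards [hzc, hy0] with ω h1 h2
    rw [h1]; linarith
  have hz0 : ∀ᵐ ω ∂μ, 0 ≤ R.toLp z ω := by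
    filter_upwards [hzc, hx0, hy0] with ω h1 h2 h3
    rw [h1]; positivity
  have h1 := hM.le_add_log hh hze hz0
  have h2 : ∫ ω, (|h ω| * Real.log (R.toLp x ω) / 2 + |h ω| * Real.log (R.toLp y ω) / 2) ∂μ ≤
      ∫ ω, |h ω| * Real.log (R.toLp z ω) ∂μ := by
    refine integral_mono_ae ((hx.integrable.div_const 2).add (hy.integrable.div_const 2))
      hze.integrable ?_
    filter_upwards [hzc, hx.pos, hy.pos] with ω h3 h4 h5
    by_cases h0 : h ω = 0
    · simp [h0]
    · rw [h3]
      have := mul_le_mul_of_nonneg_left (log_add_log_le (h4 h0) (h5 h0)) (abs_nonneg (h ω))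
      linarith
  rw [integral_add (hx.integrable.div_const 2) (hy.integrable.div_const 2), integral_div,
    integral_div] at h2
  have hn : 0 < ‖z‖ := norm_pos_iff.2 (ne_zero_of_hasEntropy hh hze)
  have h3 := Real.log_le_sub_one_of_pos hn
  have h4 : ‖z‖ = (1 / 2) * ‖x + y‖ := by
    rw [hz, norm_smul, Real.norm_of_nonneg (by norm_num)]
  linarith

theorem integral_mul_coeFn_le [IsFiniteMeasure μ] (hh : IsWeight μ h C) (x : X) :
    |∫ ω, |h ω| * R.toLp x ω ∂μ| ≤ C * ‖x‖ := by
  have hC : 0 ≤ C := by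
    by_contra hC
    exact hh.not_ae_eq_zero (hh.abs_le.mono fun ω h1 =>
      absurd ((abs_nonneg _).trans h1) hC)
  refine abs_integral_le_integral_abs.trans ?_
  have h1 : ∫ ω, |(|h ω| * R.toLp x ω)| ∂μ ≤ ∫ ω, C * |R.toLp x ω| ∂μ := by
    refine integral_mono_ae (hh.integrable_mul (R.integrable_coeFn x)).abs
      ((R.integrable_coeFn x).abs.const_mul C) (hh.abs_le.mono fun ω h1 => ?_)
    simp only [abs_mul, abs_abs]
    exact mul_le_mul_of_nonneg_right h1 (abs_nonneg _)
  rw [integral_const_mul, ← R.norm_toLp_eq] at h1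
  exact h1.trans (mul_le_mul_of_nonneg_left (R.norm_toLp_le x) hC)

/-- The entropy is upper semicontinuous. -/
theorem hasEntropy_of_tendsto [IsFiniteMeasure μ] (hh : IsWeight μ h C) {k : ℕ → X}
    (hk : ∀ n, HasEntropy μ h (R.toLp (k n))) (hk0 : ∀ n, ∀ᵐ ω ∂μ, 0 ≤ R.toLp (k n) ω)
    (hkx : Tendsto k atTop (𝓝 x))
    (hkM : Tendsto (fun n => ∫ ω, |h ω| * Real.log (R.toLp (k n) ω) ∂μ) atTop (𝓝 M)) :
    (∀ᵐ ω ∂μ, 0 ≤ R.toLp x ω) ∧ HasEntropy μ h (R.toLp x) ∧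
      M ≤ ∫ ω, |h ω| * Real.log (R.toLp x ω) ∂μ := by
  obtain ⟨ns, hns, hae⟩ := R.exists_subseq_tendsto_ae hkx
  have hk0' := ae_all_iff.2 hk0
  have hpos' := ae_all_iff.2 fun n => (hk n).pos
  have hx0 : ∀ᵐ ω ∂μ, 0 ≤ R.toLp x ω := by
    filter_upwards [hae, hk0'] with ω h1 h2
    exact ge_of_tendsto' h1 fun i => h2 _
  refine ⟨hx0, ?_⟩
  -- Subtracting the entropy from the continuous linear term `∫ |h| f` makes the integrand
  -- nonnegative, so Fatou's lemma applies.
  set u : (Ω → ℝ) → Ω → ℝ := fun f ω => |h ω| * f ω - |h ω| * Real.log (f ω) with hu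
  have hu0 : ∀ f ω, 0 ≤ f ω → 0 ≤ u f ω := fun f ω hf => by
    rw [hu]
    have := mul_le_mul_of_nonneg_left (Real.log_le_self hf) (abs_nonneg (h ω))
    simp only; linarith
  have hum : ∀ z : X, Measurable (u (R.toLp z)) := fun z =>
    (hh.measurable.abs.mul (R.measurable_coeFn z)).sub
      (hh.measurable.abs.mul (R.measurable_coeFn z).log)
  have hI : ∀ n, Integrable (u (R.toLp (k n))) μ := fun n =>
    (hh.integrable_mul (R.integrable_coeFn _)).sub (hk n).integrable
  have hIeq : ∀ n, ∫ ω, u (R.toLp (k n)) ω ∂μ = ∫ ω, |h ω| * R.toLp (k n) ω ∂μ -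
      ∫ ω, |h ω| * Real.log (R.toLp (k n) ω) ∂μ := fun n =>
    integral_sub (hh.integrable_mul (R.integrable_coeFn _)) (hk n).integrable
  have hlin : Tendsto (fun n => ∫ ω, |h ω| * R.toLp (k n) ω ∂μ) atTop
      (𝓝 (∫ ω, |h ω| * R.toLp x ω ∂μ)) := by
    rw [tendsto_iff_norm_sub_tendsto_zero]
    have h1 : Tendsto (fun n => C * ‖k n - x‖) atTop (𝓝 0) := by
      simpa using (tendsto_iff_norm_sub_tendsto_zero.1 hkx).const_mul C
    refine squeeze_zero (fun n => norm_nonneg _) (fun n => ?_) h1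
    rw [← integral_sub (hh.integrable_mul (R.integrable_coeFn _))
      (hh.integrable_mul (R.integrable_coeFn _)), Real.norm_eq_abs]
    refine le_of_eq_of_le (congrArg _ (integral_congr_ae ?_))
      (integral_mul_coeFn_le (R := R) hh (k n - x))
    filter_upwards [R.coeFn_sub (k n) x] with ω h2
    rw [h2]; ring
  set L := ∫ ω, |h ω| * R.toLp x ω ∂μ - M with hL
  have hIL : Tendsto (fun n => ∫ ω, u (R.toLp (k n)) ω ∂μ) atTop (𝓝 L) := by
    simp only [hIeq]; exact hlin.sub hkM
  have hL0 : 0 ≤ L := ge_of_tendsto' hIL fun n =>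
    integral_nonneg_of_ae ((hk0 n).mono fun ω h1 => hu0 _ ω h1)
  have hfatou : ∫⁻ ω, liminf (fun i => ENNReal.ofReal (u (R.toLp (k (ns i))) ω)) atTop ∂μ ≤
      ENNReal.ofReal L := by
    refine (lintegral_liminf_le fun i => (hum _).ennreal_ofReal).trans ?_
    have h1 : Tendsto (fun i => ∫⁻ ω, ENNReal.ofReal (u (R.toLp (k (ns i))) ω) ∂μ) atTop
        (𝓝 (ENNReal.ofReal L)) := by
      refine (ENNReal.tendsto_ofReal (hIL.comp hns.tendsto_atTop)).congr fun i => ?_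
      exact ofReal_integral_eq_lintegral_ofReal (hI _)
        ((hk0 _).mono fun ω h1 => hu0 _ ω h1)
    rw [h1.liminf_eq]
  have hlimpos : ∀ᵐ ω ∂μ, 0 < R.toLp x ω →
      liminf (fun i => ENNReal.ofReal (u (R.toLp (k (ns i))) ω)) atTop =
        ENNReal.ofReal (u (R.toLp x) ω) := by
    filter_upwards [hae] with ω h1 h2
    refine Tendsto.liminf_eq (ENNReal.tendsto_ofReal ?_)
    exact (h1.const_mul _).sub ((h1.log h2.ne').const_mul _)
  -- If the limit vanished where `h ≠ 0`, then `u` would tend to `∞` there, against the finite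
  -- integral of its lower limit.
  have hpos : ∀ᵐ ω ∂μ, h ω ≠ 0 → 0 < R.toLp x ω := by
    have hfin := ae_lt_top (Measurable.liminf fun i => (hum (k (ns i))).ennreal_ofReal)
      (hfatou.trans_lt ENNReal.ofReal_lt_top).ne
    filter_upwards [hae, hpos', hx0, hfin] with ω h1 h2 h3 h4 h5
    refine h3.lt_of_ne fun h6 => h4.ne (Tendsto.liminf_eq ?_)
    rw [← h6] at h1
    refine ENNReal.tendsto_ofReal_nhds_top.2 ?_
    have h7 : Tendsto (fun i => R.toLp (k (ns i)) ω) atTop (𝓝[>] 0) :=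
      tendsto_nhdsWithin_iff.2 ⟨h1, Eventually.of_forall fun i => h2 _ h5⟩
    have h8 := (Real.tendsto_log_nhdsGT_zero.comp h7).const_mul_atBot (abs_pos.2 h5)
    simp only [hu, sub_eq_add_neg]
    exact (h1.const_mul |h ω|).add_atTop (tendsto_neg_atBot_atTop.comp h8)
  have hle : ∫⁻ ω, ENNReal.ofReal (u (R.toLp x) ω) ∂μ ≤ ENNReal.ofReal L := by
    refine (lintegral_mono_ae ?_).trans hfatou
    filter_upwards [hlimpos, hpos] with ω h1 h2
    by_cases h0 : h ω = 0
    · simp [hu, h0]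
    · exact (h1 (h2 h0)).ge
  have hux0 : 0 ≤ᵐ[μ] u (R.toLp x) := hx0.mono fun ω h1 => hu0 _ ω h1
  have hux : Integrable (u (R.toLp x)) μ :=
    (lintegral_ofReal_ne_top_iff_integrable (hum x).aestronglyMeasurable hux0).1
      (hle.trans_lt ENNReal.ofReal_lt_top).ne
  have hlog : Integrable (fun ω => |h ω| * Real.log (R.toLp x ω)) μ :=
    ((hh.integrable_mul (R.integrable_coeFn x)).sub hux).congr
      (Eventually.of_forall fun ω => by simp [hu])
  refine ⟨⟨hpos, hlog⟩, ?_⟩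
  rw [← ofReal_integral_eq_lintegral_ofReal hux hux0, ENNReal.ofReal_le_ofReal_iff hL0,
    integral_sub (hh.integrable_mul (R.integrable_coeFn x)) hlog] at hle
  linarith

/-- The direct method without compactness: a maximizing sequence is Cauchy by `le_norm_add` and
uniform convexity, and upper semicontinuity passes to the limit. -/
theorem exists_entropy_eq_bound [IsFiniteMeasure μ] [CompleteSpace X] [UniformConvexSpace X]
    (R : FunctionLattice μ X) (hh : IsWeight μ h C) :
    ∃ (M : ℝ) (x : X), R.EntropyBound h M ∧ (∀ᵐ ω ∂μ, 0 ≤ R.toLp x ω) ∧ ‖x‖ = 1 ∧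
      HasEntropy μ h (R.toLp x) ∧ ∫ ω, |h ω| * Real.log (R.toLp x ω) ∂μ = M := by
  set S : Set ℝ := {r | ∃ k : X, (∀ᵐ ω ∂μ, 0 ≤ R.toLp k ω) ∧ ‖k‖ ≤ 1 ∧
    HasEntropy μ h (R.toLp k) ∧ ∫ ω, |h ω| * Real.log (R.toLp k ω) ∂μ = r} with hS
  have hSne : S.Nonempty := by
    obtain ⟨e, he, -⟩ := R.exists_of_bound (f := fun _ => (1 : ℝ)) aestronglyMeasurable_const 1
      (by simp)
    have hc : 0 < (‖e‖ + 1)⁻¹ := by positivity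
    have hee : HasEntropy μ h (R.toLp e) := by
      refine ⟨he.mono fun ω h1 _ => by rw [h1]; exact one_pos, ?_⟩
      refine (integrable_zero Ω ℝ μ).congr (he.mono fun ω h1 => ?_)
      simp only
      rw [h1]; simp
    refine ⟨_, (‖e‖ + 1)⁻¹ • e, ?_, ?_, (hasEntropy_smul hh hee hc).1, rfl⟩
    · filter_upwards [R.coeFn_smul (‖e‖ + 1)⁻¹ e, he] with ω h1 h2
      rw [h1, h2]; positivity
    · rw [norm_smul, Real.norm_of_nonneg hc.le, inv_mul_le_iff₀ (by positivity)]
      linarith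
  have hSb : BddAbove S := by
    refine ⟨|C|, ?_⟩
    rintro _ ⟨k, hk0, hk1, hk, rfl⟩
    have h1 : ∫ ω, |h ω| * Real.log (R.toLp k ω) ∂μ ≤ ∫ ω, |h ω| * R.toLp k ω ∂μ :=
      integral_mono_ae hk.integrable (hh.integrable_mul (R.integrable_coeFn k))
        (hk0.mono fun ω h2 => mul_le_mul_of_nonneg_left (Real.log_le_self h2) (abs_nonneg _))
    refine h1.trans ((le_abs_self _).trans ((integral_mul_coeFn_le hh k).trans ?_))
    exact (mul_le_mul_of_nonneg_right (le_abs_self C) (norm_nonneg _)).trans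
      (mul_le_of_le_one_right (abs_nonneg _) hk1)
  set M := sSup S with hM
  have hbound : R.EntropyBound h M := fun k hk0 hk1 hk => le_csSup hSb ⟨k, hk0, hk1, hk, rfl⟩
  have hseq : ∀ n : ℕ, ∃ k : X, (∀ᵐ ω ∂μ, 0 ≤ R.toLp k ω) ∧ ‖k‖ ≤ 1 ∧
      HasEntropy μ h (R.toLp k) ∧
      M - 1 / (n + 1) ≤ ∫ ω, |h ω| * Real.log (R.toLp k ω) ∂μ := fun n => by
    obtain ⟨_, ⟨k, hk0, hk1, hk, rfl⟩, h1⟩ := exists_lt_of_lt_csSup hSne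
      (show M - 1 / ((n : ℝ) + 1) < sSup S by
        rw [← hM]; exact sub_lt_self _ Nat.one_div_pos_of_nat)
    exact ⟨k, hk0, hk1, hk, h1.le⟩
  choose k hk0 hk1 hk hkM using hseq
  have hcauchy : CauchySeq k := by
    rw [Metric.cauchySeq_iff']
    intro ε hε
    obtain ⟨δ, hδ, hUC⟩ := exists_forall_closed_ball_dist_add_le_two_sub X hε
    obtain ⟨N, hN⟩ := exists_nat_one_div_lt (show 0 < δ / 2 by positivity)
    refine ⟨N, fun n hn => ?_⟩
    by_contra! hcon
    rw [dist_eq_norm] at hcon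
    have h1 := hUC (hk1 n) (hk1 N) hcon
    have h2 := hbound.le_norm_add hh (hk n) (hk0 n) (hk N) (hk0 N) (δ := 1 / ((N : ℝ) + 1))
      ((sub_le_sub_left (Nat.one_div_le_one_div hn) M).trans (hkM n)) (hkM N)
    linarith
  obtain ⟨x, hx⟩ := cauchySeq_tendsto_of_complete hcauchy
  have hlim : Tendsto (fun n => ∫ ω, |h ω| * Real.log (R.toLp (k n) ω) ∂μ) atTop (𝓝 M) := by
    refine tendsto_of_tendsto_of_tendsto_of_le_of_le ?_ tendsto_const_nhds hkM
      fun n => hbound _ (hk0 n) (hk1 n) (hk n)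
    simpa using tendsto_one_div_add_atTop_nhds_zero_nat.const_sub M
  obtain ⟨h1, h2, h3⟩ := hasEntropy_of_tendsto hh hk hk0 hx hlim
  have h4 : ‖x‖ ≤ 1 := le_of_tendsto' hx.norm hk1
  have h5 := hbound x h1 h4 h2
  refine ⟨M, x, hbound, h1, le_antisymm h4 ?_, h2, le_antisymm h5 h3⟩
  -- The pair `x, x` with `δ = 0` gives `2 ≤ ‖x + x‖`.
  have h6 := hbound.le_norm_add hh h2 h1 h2 h1 (δ := 0) (by linarith) (by linarith)
  rw [← two_smul ℝ x, norm_smul, Real.norm_of_nonneg (by norm_num)] at h6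
  linarith

/-- A maximizer of the entropy has finite entropy. -/
theorem isEntropyMaximizer_iff [IsFiniteMeasure μ] [CompleteSpace X] [UniformConvexSpace X]
    (hh : IsWeight μ h C) :
    R.IsEntropyMaximizer h x ↔ (∀ᵐ ω ∂μ, 0 ≤ R.toLp x ω) ∧ ‖x‖ = 1 ∧
      HasEntropy μ h (R.toLp x) ∧
      R.EntropyBound h (∫ ω, |h ω| * Real.log (R.toLp x ω) ∂μ) := by
  constructor
  · rintro ⟨h1, h2, h3⟩
    rw [R.nonneg_iff] at h1
    obtain ⟨M, y, -, hy0, hy1, hy, -⟩ := R.exists_entropy_eq_bound hh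
    have h4 : HasEntropy μ h (R.toLp x) :=
      hh.hasEntropy_of_ne_bot (R.measurable_coeFn x) (R.integrable_coeFn x) h1 fun h4 => by
        have h5 := h3 y ((R.nonneg_iff y).2 hy0) hy1.le
        rw [h4, hy.entropy_eq] at h5
        exact EReal.coe_ne_bot _ (le_bot_iff.1 h5)
    refine ⟨h1, h2, h4, fun k hk0 hk1 hk => ?_⟩
    have h5 := h3 k ((R.nonneg_iff k).2 hk0) hk1
    rw [hk.entropy_eq, h4.entropy_eq] at h5
    exact EReal.coe_le_coe_iff.1 h5
  · rintro ⟨h1, h2, h3, h4⟩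
    refine ⟨(R.nonneg_iff x).2 h1, h2, fun k hk0 hk1 => ?_⟩
    rw [R.nonneg_iff] at hk0
    by_cases hb : entropy μ h (R.toLp k) = ⊥
    · rw [hb]; exact bot_le
    have hk := hh.hasEntropy_of_ne_bot (R.measurable_coeFn k) (R.integrable_coeFn k) hk0 hb
    rw [hk.entropy_eq, h3.entropy_eq]
    exact EReal.coe_le_coe_iff.2 (h4 k hk0 hk1 hk)

theorem existsUnique_isEntropyMaximizer [IsFiniteMeasure μ] [CompleteSpace X]
    [UniformConvexSpace X] (R : FunctionLattice μ X) (hh : IsWeight μ h C) :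
    ∃! x : X, R.IsEntropyMaximizer h x := by
  obtain ⟨M, x, hM, hx0, hx1, hx, rfl⟩ := R.exists_entropy_eq_bound hh
  refine ⟨x, (isEntropyMaximizer_iff hh).2 ⟨hx0, hx1, hx, hM⟩, fun y hy => ?_⟩
  obtain ⟨hy0, hy1, hy, hyM⟩ := (isEntropyMaximizer_iff hh).1 hy
  have h1 := hM y hy0 hy1.le hy
  have h2 := hyM x hx0 hx1.le hx
  have h3 := hM.le_norm_add hh hy hy0 hx hx0 (δ := 0) (by linarith) (by linarith)
  by_contra hne
  obtain ⟨δ, hδ, hUC⟩ := exists_forall_closed_ball_dist_add_le_two_sub X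
    (norm_pos_iff.2 (sub_ne_zero.2 hne))
  have := hUC hy1.le hx1.le le_rfl
  linarith

end FunctionLattice

end Entropy

/-! ### The supporting functional at a maximizer. -/

namespace FunctionLattice

section MaximizerPolar

variable {Ω : Type u} [MeasurableSpace Ω] {μ : Measure Ω}
  {X : Type v} [NormedAddCommGroup X] [NormedSpace ℝ X] {R : FunctionLattice μ X}
  {h : Ω → ℝ} {C : ℝ} {f : X}

/-- The first variation of the entropy at a maximizer. -/
theorem lintegral_mul_div_le (hh : IsWeight μ h C) (hf0 : ∀ᵐ ω ∂μ, 0 ≤ R.toLp f ω)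
    (hf1 : ‖f‖ = 1) (hf : HasEntropy μ h (R.toLp f))
    (hM : R.EntropyBound h (∫ ω, |h ω| * Real.log (R.toLp f ω) ∂μ)) {k : X}
    (hk0 : ∀ᵐ ω ∂μ, 0 ≤ R.toLp k ω) :
    ∫⁻ ω, ENNReal.ofReal (|h ω| * (R.toLp k ω / R.toLp f ω)) ∂μ ≤ ENNReal.ofReal ‖k‖ := by
  have hfm := R.measurable_coeFn f
  have hkm := R.measurable_coeFn k
  -- The difference quotient of the entropy along `f + t k` is at most `t⁻¹ log ‖f + t k‖ ≤ ‖k‖`. By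
  -- `log a ≥ 1 - 1 / a` its integrand dominates `|h| k / (f + t k)`; Fatou's lemma then lets `t →
  -- 0`.
  have hstep : ∀ t : ℝ, 0 < t →
      ∫⁻ ω, ENNReal.ofReal (|h ω| * (R.toLp k ω / (R.toLp f ω + t * R.toLp k ω))) ∂μ ≤
        ENNReal.ofReal ‖k‖ := by
    intro t ht
    set z : X := f + t • k with hz
    have hzc : R.toLp z =ᵐ[μ] fun ω => R.toLp f ω + t * R.toLp k ω := by
      filter_upwards [R.coeFn_add f (t • k), R.coeFn_smul t k] with ω h1 h2
      rw [hz, h1, h2]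
    have hzf : ∀ᵐ ω ∂μ, R.toLp f ω ≤ R.toLp z ω := by
      filter_upwards [hzc, hk0] with ω h1 h2
      rw [h1]; exact le_add_of_nonneg_right (mul_nonneg ht.le h2)
    have hze : HasEntropy μ h (R.toLp z) :=
      hf.of_mul_le hh (R.measurable_coeFn _) (R.integrable_coeFn _) one_pos
        (hzf.mono fun ω h1 => by rwa [one_mul])
    have hz0 : ∀ᵐ ω ∂μ, 0 ≤ R.toLp z ω := by
      filter_upwards [hzf, hf0] with ω h1 h2 using h2.trans h1
    have h1 := hM.le_add_log hh hze hz0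
    have hn : 0 < ‖z‖ := norm_pos_iff.2 (ne_zero_of_hasEntropy hh hze)
    have h2 := Real.log_le_sub_one_of_pos hn
    have h3 : ‖z‖ ≤ 1 + t * ‖k‖ := by
      refine (norm_add_le _ _).trans ?_
      rw [hf1, norm_smul, Real.norm_of_nonneg ht.le]
    have hdi : Integrable (fun ω => t⁻¹ * (|h ω| * Real.log (R.toLp z ω) -
        |h ω| * Real.log (R.toLp f ω))) μ := (hze.integrable.sub hf.integrable).const_mul _
    have hd : ∫ ω, t⁻¹ * (|h ω| * Real.log (R.toLp z ω) - |h ω| * Real.log (R.toLp f ω)) ∂μ ≤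
        ‖k‖ := by
      rw [integral_const_mul, integral_sub hze.integrable hf.integrable, inv_mul_le_iff₀ ht]
      linarith
    have hpt : ∀ᵐ ω ∂μ, |h ω| * (R.toLp k ω / (R.toLp f ω + t * R.toLp k ω)) ≤
        t⁻¹ * (|h ω| * Real.log (R.toLp z ω) - |h ω| * Real.log (R.toLp f ω)) := by
      filter_upwards [hzc, hk0, hf.pos, hze.pos] with ω h4 h5 h6 h7
      by_cases h0 : h ω = 0
      · simp [h0]
      have hfp := h6 h0
      have hzp := h7 h0
      have h8 := Real.one_sub_inv_le_log_of_pos (div_pos hzp hfp)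
      rw [Real.log_div hzp.ne' hfp.ne', inv_div] at h8
      have h9 : R.toLp k ω / (R.toLp f ω + t * R.toLp k ω) =
          t⁻¹ * (1 - R.toLp f ω / R.toLp z ω) := by
        rw [← h4]
        field_simp
        rw [h4]; ring
      rw [h9, mul_left_comm, ← mul_sub]
      exact mul_le_mul_of_nonneg_left (mul_le_mul_of_nonneg_left h8 (abs_nonneg _))
        (inv_nonneg.2 ht.le)
    refine (lintegral_mono_ae (hpt.mono fun ω h4 => ENNReal.ofReal_le_ofReal h4)).trans ?_
    rw [← ofReal_integral_eq_lintegral_ofReal hdi]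
    · exact ENNReal.ofReal_le_ofReal hd
    · filter_upwards [hpt, hk0, hf0] with ω h4 h5 h6
      refine le_trans ?_ h4
      positivity
  have hm : ∀ n : ℕ, Measurable fun ω => ENNReal.ofReal
      (|h ω| * (R.toLp k ω / (R.toLp f ω + 1 / ((n : ℝ) + 1) * R.toLp k ω))) := fun n =>
    (hh.measurable.abs.mul (hkm.div (hfm.add (hkm.const_mul _)))).ennreal_ofReal
  calc ∫⁻ ω, ENNReal.ofReal (|h ω| * (R.toLp k ω / R.toLp f ω)) ∂μ
      ≤ ∫⁻ ω, liminf (fun n : ℕ => ENNReal.ofReal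
          (|h ω| * (R.toLp k ω / (R.toLp f ω + 1 / ((n : ℝ) + 1) * R.toLp k ω)))) atTop ∂μ := by
        refine lintegral_mono_ae (hf.pos.mono fun ω h1 => ?_)
        by_cases h0 : h ω = 0
        · simp [h0]
        refine (Tendsto.liminf_eq (ENNReal.tendsto_ofReal ?_)).ge
        have h2 : Tendsto (fun n : ℕ => R.toLp f ω + 1 / ((n : ℝ) + 1) * R.toLp k ω) atTop
            (𝓝 (R.toLp f ω)) := by
          simpa using
            (tendsto_one_div_add_atTop_nhds_zero_nat.mul_const (R.toLp k ω)).const_add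
              (R.toLp f ω)
        exact (tendsto_const_nhds.div h2 (h1 h0).ne').const_mul _
    _ ≤ liminf (fun n : ℕ => ∫⁻ ω, ENNReal.ofReal
          (|h ω| * (R.toLp k ω / (R.toLp f ω + 1 / ((n : ℝ) + 1) * R.toLp k ω))) ∂μ) atTop :=
        lintegral_liminf_le hm
    _ ≤ ENNReal.ofReal ‖k‖ :=
        liminf_le_of_frequently_le' (Frequently.of_forall fun n =>
          hstep _ Nat.one_div_pos_of_nat)

/-- If `f` maximizes the entropy for `h`, then `h / f` is a supporting functional of
`sign h · f`, and the polar of `sign h · f` is `h`. -/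
theorem exists_polar_of_maximizer (hh : IsWeight μ h C) (hf0 : ∀ᵐ ω ∂μ, 0 ≤ R.toLp f ω)
    (hf1 : ‖f‖ = 1) (hf : HasEntropy μ h (R.toLp f))
    (hM : R.EntropyBound h (∫ ω, |h ω| * Real.log (R.toLp f ω) ∂μ)) :
    ∃ (x : X) (φ : StrongDual ℝ X) (g : Ω → ℝ), ‖x‖ = 1 ∧ IsSupportingFunctional φ x ∧
      R.Represents g φ ∧ R.toLp x =ᵐ[μ] (fun ω => Real.sign (h ω) * R.toLp f ω) ∧
      (fun ω => |g ω| * R.toLp x ω) =ᵐ[μ] h := by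
  have hfm := R.measurable_coeFn f
  -- Almost everywhere `f = 0` occurs only where `h = 0`, and there the quotient is `0`.
  set g : Ω → ℝ := fun ω => h ω / R.toLp f ω with hg
  have hgm : Measurable g := hh.measurable.div hfm
  have hbound : ∀ y : X, Integrable (fun ω => g ω * R.toLp y ω) μ ∧
      ∫ ω, |g ω * R.toLp y ω| ∂μ ≤ ‖y‖ := by
    intro y
    obtain ⟨k, hk, hnk⟩ := R.exists_abs y
    have h1 := lintegral_mul_div_le hh hf0 hf1 hf hM (k := k)
      (hk.mono fun ω h1 => by rw [h1]; exact abs_nonneg _)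
    have h2 : ∫⁻ ω, ENNReal.ofReal (|h ω| * (R.toLp k ω / R.toLp f ω)) ∂μ =
        ∫⁻ ω, ENNReal.ofReal |g ω * R.toLp y ω| ∂μ := by
      refine lintegral_congr_ae ?_
      filter_upwards [hk, hf0] with ω h3 h4
      rw [h3, abs_mul, hg, abs_div, abs_of_nonneg h4]
      congr 1; ring
    rw [h2, hnk] at h1
    have hm : Measurable fun ω => g ω * R.toLp y ω := hgm.mul (R.measurable_coeFn y)
    have h0 : 0 ≤ᵐ[μ] fun ω => |g ω * R.toLp y ω| := Eventually.of_forall fun ω => abs_nonneg _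
    have hi := (lintegral_ofReal_ne_top_iff_integrable hm.abs.aestronglyMeasurable h0).1
      (h1.trans_lt ENNReal.ofReal_lt_top).ne
    refine ⟨(integrable_norm_iff hm.aestronglyMeasurable).1 hi, ?_⟩
    rwa [← ofReal_integral_eq_lintegral_ofReal hi h0,
      ENNReal.ofReal_le_ofReal_iff (norm_nonneg _)] at h1
  let φ₀ : X →ₗ[ℝ] ℝ :=
    { toFun := fun y => ∫ ω, g ω * R.toLp y ω ∂μ
      map_add' := fun y z => by
        rw [← integral_add (hbound y).1 (hbound z).1]
        refine integral_congr_ae ((R.coeFn_add y z).mono fun ω h1 => ?_)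
        simp only [h1]; ring
      map_smul' := fun c y => by
        rw [RingHom.id_apply, smul_eq_mul, ← integral_const_mul]
        refine integral_congr_ae ((R.coeFn_smul c y).mono fun ω h1 => ?_)
        simp only [h1]; ring }
  have hφ₀ : ∀ y, ‖φ₀ y‖ ≤ 1 * ‖y‖ := fun y => by
    rw [one_mul]; exact abs_integral_le_integral_abs.trans (hbound y).2
  have hsign : Measurable fun ω => Real.sign (h ω) := by
    unfold Real.sign
    exact Measurable.ite (measurableSet_lt hh.measurable measurable_const) measurable_const
      (Measurable.ite (measurableSet_lt measurable_const hh.measurable) measurable_const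
        measurable_const)
  have hsle : ∀ r : ℝ, |Real.sign r| ≤ 1 := fun r => by
    rcases Real.sign_apply_eq r with h1 | h1 | h1 <;> simp [h1]
  obtain ⟨x, hx⟩ := R.exists_of_ae_le f (f := fun ω => Real.sign (h ω) * R.toLp f ω)
    (hsign.mul hfm).aestronglyMeasurable (Eventually.of_forall fun ω => by
      rw [abs_mul]; exact mul_le_of_le_one_left (abs_nonneg _) (hsle _))
  have hx1 : ‖x‖ ≤ 1 := by
    rw [← hf1]
    refine R.norm_le_of_ae_le (hx.mono fun ω h1 => ?_)
    rw [h1, abs_mul]; exact mul_le_of_le_one_left (abs_nonneg _) (hsle _)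
  set φ : StrongDual ℝ X := φ₀.mkContinuous 1 hφ₀ with hφ
  have hφ1 : ‖φ‖ ≤ 1 := φ₀.mkContinuous_norm_le zero_le_one hφ₀
  have hφx : φ x = 1 := by
    change ∫ ω, g ω * R.toLp x ω ∂μ = 1
    rw [← hh.integral_abs]
    refine integral_congr_ae ?_
    filter_upwards [hx, hf.pos] with ω h1 h2
    rw [h1]
    by_cases h0 : h ω = 0
    · simp [h0, hg]
    · have h3 := (h2 h0).ne'
      simp only [hg]
      rcases lt_or_gt_of_ne h0 with h4 | h4
      · rw [Real.sign_of_neg h4, abs_of_neg h4]; field_simp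
      · rw [Real.sign_of_pos h4, abs_of_pos h4]; field_simp
  -- `‖φ‖ ≤ 1`, `‖x‖ ≤ 1` and `φ x = 1` force both norms to be `1`.
  have hle := (le_abs_self _).trans (φ.le_opNorm x)
  rw [hφx] at hle
  refine ⟨x, φ, g, le_antisymm hx1 ?_, ⟨le_antisymm hφ1 ?_, hφx⟩,
    ⟨hgm.aestronglyMeasurable, fun y => ⟨(hbound y).1, rfl⟩⟩, hx, ?_⟩
  · exact hle.trans (mul_le_of_le_one_left (norm_nonneg _) hφ1)
  · exact hle.trans (mul_le_of_le_one_right (norm_nonneg _) hx1)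
  · filter_upwards [hx, hf.pos] with ω h1 h2
    rw [h1]
    by_cases h0 : h ω = 0
    · simp [h0]
    · have h3 := h2 h0
      simp only [hg]
      rw [abs_div, abs_of_pos h3]
      rcases lt_or_gt_of_ne h0 with h4 | h4
      · rw [Real.sign_of_neg h4, abs_of_neg h4]; field_simp
      · rw [Real.sign_of_pos h4, abs_of_pos h4]; field_simp

end MaximizerPolar

end FunctionLattice

/-! ### Bounded functions in the unit sphere of `L₁(μ)`. -/

section Sphere

variable {Ω : Type u} [MeasurableSpace Ω] {μ : Measure Ω}

theorem exists_isWeight {h : Lp ℝ 1 μ} (h1 : ‖h‖ = 1) (hb : MemLp h ∞ μ) :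
    ∃ C, IsWeight μ h C := by
  refine ⟨(eLpNorm h ∞ μ).toReal, (Lp.stronglyMeasurable _).measurable, ?_, ?_⟩
  · filter_upwards [ae_le_eLpNormEssSup (f := h) (μ := μ)] with ω h2
    rw [← eLpNorm_exponent_top] at h2
    rw [← Real.norm_eq_abs, ← toReal_enorm]
    exact ENNReal.toReal_mono hb.2.ne h2
  · rw [← h1, L1.norm_eq_integral_norm]; rfl

theorem dist_sphere_eq_integral {h₁ h₂ : sphere (0 : Lp ℝ 1 μ) 1} {f₁ f₂ : Ω → ℝ}
    (e₁ : (h₁ : Lp ℝ 1 μ) =ᵐ[μ] f₁) (e₂ : (h₂ : Lp ℝ 1 μ) =ᵐ[μ] f₂) :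
    dist h₁ h₂ = ∫ ω, |f₁ ω - f₂ ω| ∂μ := by
  rw [Subtype.dist_eq, dist_eq_norm, L1.norm_eq_integral_norm]
  refine integral_congr_ae ?_
  filter_upwards [e₁, e₂, Lp.coeFn_sub (h₁ : Lp ℝ 1 μ) h₂] with ω h1 h2 h3
  rw [h3, Pi.sub_apply, h1, h2, Real.norm_eq_abs]

theorem dense_bounded_sphere [IsFiniteMeasure μ] :
    Dense {h : sphere (0 : Lp ℝ 1 μ) 1 | MemLp (h : Lp ℝ 1 μ) ∞ μ} := by
  rw [Metric.dense_iff]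
  rintro ⟨h, hh⟩ ε hε
  rw [mem_sphere_zero_iff_norm] at hh
  -- Normalizing `s` moves it by `|1 - ‖s‖| ≤ ‖h - s‖`, which accounts for `ε / 2`; the bound `1`
  -- keeps `s` away from `0`.
  obtain ⟨s, hs⟩ := (Lp.simpleFunc.denseRange (E := ℝ) (p := 1) (μ := μ)
    ENNReal.one_ne_top).exists_dist_lt h (show 0 < min (ε / 2) 1 by positivity)
  rw [dist_eq_norm, lt_min_iff] at hs
  have h1 : |‖h‖ - ‖(s : Lp ℝ 1 μ)‖| ≤ ‖h - s‖ := abs_norm_sub_norm_le _ _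
  rw [hh] at h1
  have hpos : 0 < ‖(s : Lp ℝ 1 μ)‖ := by linarith [(abs_le.1 h1).2, hs.2]
  have hb : MemLp ((‖(s : Lp ℝ 1 μ)‖⁻¹ • (s : Lp ℝ 1 μ) : Lp ℝ 1 μ)) ∞ μ := by
    refine MemLp.ae_eq (Lp.coeFn_smul _ _).symm (MemLp.const_smul ?_ _)
    exact MemLp.ae_eq (Lp.simpleFunc.toSimpleFunc_eq_toFun s)
      ((Lp.simpleFunc.toSimpleFunc s).memLp_top μ)
  refine ⟨⟨‖(s : Lp ℝ 1 μ)‖⁻¹ • (s : Lp ℝ 1 μ), ?_⟩, ?_, hb⟩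
  · rw [mem_sphere_zero_iff_norm, norm_smul, norm_inv, norm_norm, inv_mul_cancel₀ hpos.ne']
  · rw [mem_ball, Subtype.dist_eq, dist_eq_norm]
    have h2 : ‖‖(s : Lp ℝ 1 μ)‖⁻¹ • (s : Lp ℝ 1 μ) - s‖ = |1 - ‖(s : Lp ℝ 1 μ)‖| := by
      have : ‖(s : Lp ℝ 1 μ)‖⁻¹ • (s : Lp ℝ 1 μ) - s =
          (‖(s : Lp ℝ 1 μ)‖⁻¹ - 1) • (s : Lp ℝ 1 μ) := by rw [sub_smul, one_smul]
      rw [this, norm_smul, Real.norm_eq_abs, ← abs_of_pos hpos, ← abs_mul, abs_of_pos hpos,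
        sub_mul, inv_mul_cancel₀ hpos.ne', one_mul]
    calc ‖‖(s : Lp ℝ 1 μ)‖⁻¹ • (s : Lp ℝ 1 μ) - h‖
        ≤ ‖‖(s : Lp ℝ 1 μ)‖⁻¹ • (s : Lp ℝ 1 μ) - s‖ + ‖(s : Lp ℝ 1 μ) - h‖ :=
          norm_sub_le_norm_sub_add_norm_sub _ _ _
      _ < ε := by rw [h2, norm_sub_rev]; linarith [hs.1]

end Sphere

/-! ### The polar map is a uniform homeomorphism, and the entropy map is its inverse. -/

section EntropyMap

namespace FunctionLattice

variable {Ω : Type u} [MeasurableSpace Ω] {μ : Measure Ω} [IsProbabilityMeasure μ]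
  {X : Type v} [NormedAddCommGroup X] [NormedSpace ℝ X]

theorem exists_norm_eq_one (R : FunctionLattice μ X) : ∃ x : X, ‖x‖ = 1 := by
  obtain ⟨e, he, -⟩ := R.exists_of_bound (f := fun _ => (1 : ℝ)) aestronglyMeasurable_const 1
    (by simp)
  have hne : e ≠ 0 := by
    rintro rfl
    have h0 : R.toLp (0 : X) =ᵐ[μ] 0 := by rw [map_zero]; exact Lp.coeFn_zero ℝ 1 μ
    obtain ⟨ω, h1⟩ := (h0.symm.trans he).exists
    exact zero_ne_one h1
  exact ⟨‖e‖⁻¹ • e, by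
    rw [norm_smul, norm_inv, norm_norm, inv_mul_cancel₀ (norm_ne_zero_iff.2 hne)]⟩

/-- The polar map `x ↦ |x*| x` from `S(X)` to `S(L₁(μ))`. -/
theorem exists_polar_map [CompleteSpace X] [UniformConvexSpace X] (R : FunctionLattice μ X)
    (hs : IsUniformlySmooth X) :
    ∃ G : sphere (0 : X) 1 → sphere (0 : Lp ℝ 1 μ) 1,
      ∀ (x : sphere (0 : X) 1) (φ : StrongDual ℝ X), IsSupportingFunctional φ (x : X) →
        (∃ g : Ω → ℝ, R.Represents g φ) ∧ ∀ g : Ω → ℝ, R.Represents g φ →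
          (G x : Lp ℝ 1 μ) =ᵐ[μ] fun ω => |g ω| * R.toLp (x : X) ω := by
  have hn : ∀ x : sphere (0 : X) 1, ‖(x : X)‖ = 1 := fun x => mem_sphere_zero_iff_norm.1 x.2
  have key : ∀ x : sphere (0 : X) 1, ∃ h : sphere (0 : Lp ℝ 1 μ) 1,
      ∀ φ : StrongDual ℝ X, IsSupportingFunctional φ (x : X) →
        (∃ g : Ω → ℝ, R.Represents g φ) ∧ ∀ g : Ω → ℝ, R.Represents g φ →
          (h : Lp ℝ 1 μ) =ᵐ[μ] fun ω => |g ω| * R.toLp (x : X) ω := by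
    intro x
    obtain ⟨φ, hφ⟩ := exists_isSupportingFunctional (hn x)
    obtain ⟨g, hg⟩ := R.exists_represents φ
    have hp := hg.isPolar hφ (hn x)
    have hi := hp.integrable_abs_mul (x : X)
    refine ⟨⟨hi.toL1, ?_⟩, fun ψ hψ => ⟨R.exists_represents ψ, fun k hk => ?_⟩⟩
    · rw [mem_sphere_zero_iff_norm, L1.norm_eq_integral_norm]
      refine Eq.trans (integral_congr_ae ?_) hp.integral_eq
      refine (hi.coeFn_toL1.mono fun ω h1 => ?_)
      simp only [h1, Real.norm_eq_abs, abs_mul, abs_abs]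
    · rw [hs.eq_of_isSupportingFunctional hψ hφ (hn x)] at hk
      refine hi.coeFn_toL1.trans ?_
      -- With equal functionals and equal vectors the bound is `0`, so the polar does not depend on
      -- the density chosen.
      have h1 := integral_polar_sub_le hg hk (x : X) (x : X)
      simp only [sub_self, norm_zero, zero_mul, mul_zero, add_zero] at h1
      have hj := (hk.isPolar hφ (hn x)).integrable_abs_mul (x : X)
      have h2 := (integral_eq_zero_iff_of_nonneg (fun ω => abs_nonneg _) (hi.sub hj).abs).1
        (le_antisymm h1 (integral_nonneg fun ω => abs_nonneg _))
      filter_upwards [h2] with ω h3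
      exact sub_eq_zero.1 (abs_eq_zero.1 h3)
  choose G hG using key
  exact ⟨G, hG⟩

/-- The modulus `m` is a parameter because it must be fixed before the space is; the extra `nndist x
y` is the cost of replacing `x` by `y` under a fixed functional. -/
theorem exists_entropyMap [CompleteSpace X] [UniformConvexSpace X] (R : FunctionLattice μ X)
    (hs : IsUniformlySmooth X)
    {m : ℝ≥0 → ℝ≥0} (hmc : Continuous m) (hm0 : m 0 = 0)
    (hm : ∀ (d : ℝ≥0) (v : ℝ), (∀ τ > 0, v * τ ≤ 2 * smoothnessModulus X τ + d) → v ≤ m d) :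
    (∀ h : sphere (0 : Lp ℝ 1 μ) 1, MemLp (h : Lp ℝ 1 μ) ∞ μ →
      ∃! f : X, R.IsEntropyMaximizer (h : Lp ℝ 1 μ) f) ∧
    ∃ F : sphere (0 : Lp ℝ 1 μ) 1 ≃ᵤ sphere (0 : X) 1,
      R.IsEntropyMap F ∧
      (∀ F' : sphere (0 : Lp ℝ 1 μ) 1 → sphere (0 : X) 1, R.IsEntropyMap F' → F' = F) ∧
      (∀ x y : sphere (0 : X) 1,
        nndist (F.symm x) (F.symm y) ≤ m (nndist x y) + nndist x y) ∧
      ∀ x : sphere (0 : X) 1,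
        (∃! φ : StrongDual ℝ X, IsSupportingFunctional φ (x : X)) ∧
        ∀ φ : StrongDual ℝ X, IsSupportingFunctional φ (x : X) →
          ∃ g : Ω → ℝ, R.Represents g φ ∧
            (F.symm x : Lp ℝ 1 μ) =ᵐ[μ] fun ω => |g ω| * R.toLp (x : X) ω := by
  have hn : ∀ x : sphere (0 : X) 1, ‖(x : X)‖ = 1 := fun x => mem_sphere_zero_iff_norm.1 x.2
  obtain ⟨G, hG⟩ := R.exists_polar_map hs
  have hmax : ∀ h : sphere (0 : Lp ℝ 1 μ) 1, MemLp (h : Lp ℝ 1 μ) ∞ μ →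
      ∃! f : X, R.IsEntropyMaximizer (h : Lp ℝ 1 μ) f := fun h hb => by
    obtain ⟨C, hC⟩ := exists_isWeight (mem_sphere_zero_iff_norm.1 h.2) hb
    exact R.existsUnique_isEntropyMaximizer hC
  have hGm : ∀ x y, nndist (G x) (G y) ≤ m (nndist x y) + nndist x y := by
    intro x y
    obtain ⟨φ, hφ⟩ := exists_isSupportingFunctional (hn x)
    obtain ⟨ψ, hψ⟩ := exists_isSupportingFunctional (hn y)
    obtain ⟨g, hg⟩ := (hG x φ hφ).1
    obtain ⟨k, hk⟩ := (hG y ψ hψ).1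
    have h1 := integral_polar_sub_le hg hk (x : X) (y : X)
    rw [hn x, mul_one, hψ.1, one_mul,
      ← dist_sphere_eq_integral ((hG x φ hφ).2 g hg) ((hG y ψ hψ).2 k hk),
      ← dist_eq_norm (x : X), ← Subtype.dist_eq] at h1
    have h2 := hm (nndist x y) ‖φ - ψ‖ fun τ hτ => by
      have h3 := hφ.norm_sub_mul_le hψ (hn x) hτ
      rwa [← dist_eq_norm (x : X), ← Subtype.dist_eq, ← coe_nndist] at h3
    rw [← NNReal.coe_le_coe, NNReal.coe_add, coe_nndist, coe_nndist]
    linarith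
  have hGe : IsUniformEmbedding G := by
    refine Metric.isUniformEmbedding_iff'.2 ⟨fun ε hε => ?_, fun δ hδ => ?_⟩
    · have hc : Tendsto (fun d : ℝ≥0 => m d + d) (𝓝 0) (𝓝 0) := by
        have := (hmc.add continuous_id).tendsto 0
        simpa [hm0, Pi.add_def] using this
      obtain ⟨δ, hδ, h1⟩ := Metric.tendsto_nhds_nhds.1 hc ε hε
      refine ⟨δ, hδ, fun {a b} hab => ?_⟩
      have h2 := h1 (x := nndist a b) (by simpa [NNReal.dist_eq] using hab)
      rw [NNReal.dist_eq, NNReal.coe_zero, sub_zero, abs_of_nonneg (NNReal.coe_nonneg _)] at h2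
      exact lt_of_le_of_lt (NNReal.coe_le_coe.2 (hGm a b)) h2
    · obtain ⟨ε, hε, h1⟩ := R.exists_norm_sub_lt_of_polar hδ
      refine ⟨ε, hε, fun {a b} hab => ?_⟩
      obtain ⟨φ, hφ⟩ := exists_isSupportingFunctional (hn a)
      obtain ⟨ψ, hψ⟩ := exists_isSupportingFunctional (hn b)
      obtain ⟨g, hg⟩ := (hG a φ hφ).1
      obtain ⟨k, hk⟩ := (hG b ψ hψ).1
      rw [Subtype.dist_eq, dist_eq_norm]
      refine h1 a b g k (hg.isPolar hφ (hn a)) (hk.isPolar hψ (hn b)) ?_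
      rwa [← dist_sphere_eq_integral ((hG a φ hφ).2 g hg) ((hG b ψ hψ).2 k hk)]
  have hGmax : ∀ h : sphere (0 : Lp ℝ 1 μ) 1, MemLp (h : Lp ℝ 1 μ) ∞ μ →
      ∃ (x : sphere (0 : X) 1) (f : X), G x = h ∧ R.IsEntropyMaximizer (h : Lp ℝ 1 μ) f ∧
        R.toLp (x : X) =ᵐ[μ] fun ω => Real.sign ((h : Lp ℝ 1 μ) ω) * R.toLp f ω := by
    intro h hb
    obtain ⟨C, hC⟩ := exists_isWeight (mem_sphere_zero_iff_norm.1 h.2) hb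
    obtain ⟨f, hf, -⟩ := hmax h hb
    obtain ⟨hf0, hf1, hfe, hfM⟩ := (isEntropyMaximizer_iff hC).1 hf
    obtain ⟨x, φ, g, hx1, hφ, hg, hx, hgx⟩ := exists_polar_of_maximizer hC hf0 hf1 hfe hfM
    refine ⟨⟨x, mem_sphere_zero_iff_norm.2 hx1⟩, f, ?_, hf, hx⟩
    exact Subtype.ext (Lp.ext (((hG ⟨x, mem_sphere_zero_iff_norm.2 hx1⟩ φ hφ).2 g hg).trans hgx))
  have : CompleteSpace (sphere (0 : X) 1) := isClosed_sphere.isComplete.completeSpace_coe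
  -- The range is closed, as the image of a complete space under a uniform embedding, and contains
  -- the dense set of bounded functions.
  have hsurj : Function.Surjective G := by
    intro h
    have h1 : closure (Set.range G) = Set.range G := hGe.isClosedEmbedding.isClosed_range.closure_eq
    have h2 : closure {h : sphere (0 : Lp ℝ 1 μ) 1 | MemLp (h : Lp ℝ 1 μ) ∞ μ} ⊆
        closure (Set.range G) := closure_mono fun h hb => by
      obtain ⟨x, -, hx, -⟩ := hGmax h hb
      exact ⟨x, hx⟩
    rw [h1, dense_bounded_sphere.closure_eq] at h2
    exact h2 (Set.mem_univ h)
  let e := Equiv.ofBijective G ⟨hGe.injective, hsurj⟩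
  have heG : ∀ h, G (e.symm h) = h := e.apply_symm_apply
  let F : sphere (0 : Lp ℝ 1 μ) 1 ≃ᵤ sphere (0 : X) 1 :=
    { toEquiv := e.symm
      uniformContinuous_toFun := by
        refine hGe.isUniformInducing.uniformContinuous_iff.2 ?_
        have : G ∘ e.symm = id := funext heG
        exact this ▸ uniformContinuous_id
      uniformContinuous_invFun := hGe.uniformContinuous }
  have hFG : ∀ x, F (G x) = x := e.symm_apply_apply
  have hF : R.IsEntropyMap F := by
    refine ⟨F.continuous, fun h hb => ?_⟩
    obtain ⟨x, f, rfl, hf, hx⟩ := hGmax h hb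
    exact ⟨f, hf, by rwa [hFG]⟩
  refine ⟨hmax, F, hF, fun F' hF' => ?_, hGm, fun x => ⟨?_, fun φ hφ => ?_⟩⟩
  -- Any two entropy maps agree on bounded functions, by uniqueness of the maximizer.
  · refine Continuous.ext_on dense_bounded_sphere hF'.1 hF.1 fun h hb => ?_
    obtain ⟨f, hf, hfF⟩ := hF.2 h hb
    obtain ⟨f', hf', hfF'⟩ := hF'.2 h hb
    rw [(hmax h hb).unique hf' hf] at hfF'
    exact Subtype.ext (R.ext_ae (hfF'.trans hfF.symm))
  · obtain ⟨φ, hφ⟩ := exists_isSupportingFunctional (hn x)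
    exact ⟨φ, hφ, fun ψ hψ => hs.eq_of_isSupportingFunctional hψ hφ (hn x)⟩
  · obtain ⟨⟨g, hg⟩, h1⟩ := hG x φ hφ
    exact ⟨g, hg, h1 g hg⟩

end FunctionLattice

end EntropyMap

theorem proposition2p9 (ρ : ℝ → ℝ) :
    -- a modulus of continuity that depends only on the modulus of smoothness
    ∃ m : ℝ≥0 → ℝ≥0, Continuous m ∧ m 0 = 0 ∧
      ∀ (Ω : Type u) [MeasurableSpace Ω] (μ : Measure Ω) [IsProbabilityMeasure μ]
        (X : Type v) [NormedAddCommGroup X] [NormedSpace ℝ X] [CompleteSpace X]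
        [UniformConvexSpace X] (R : FunctionLattice μ X),
        IsUniformlySmooth X → smoothnessModulus X = ρ →
          -- the entropy map is well defined: unique maximizers, unique continuous extension
          (∀ h : sphere (0 : Lp ℝ 1 μ) 1, MemLp (h : Lp ℝ 1 μ) ∞ μ →
            ∃! f : X, R.IsEntropyMaximizer (h : Lp ℝ 1 μ) f) ∧
          ∃ F : sphere (0 : Lp ℝ 1 μ) 1 ≃ᵤ sphere (0 : X) 1,
            R.IsEntropyMap F ∧
            (∀ F' : sphere (0 : Lp ℝ 1 μ) 1 → sphere (0 : X) 1, R.IsEntropyMap F' → F' = F) ∧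
            -- modulus of continuity of the inverse
            (∀ x y : sphere (0 : X) 1, nndist (F.symm x) (F.symm y) ≤ m (nndist x y)) ∧
            -- formula for the inverse
            ∀ x : sphere (0 : X) 1,
              (∃! φ : StrongDual ℝ X, IsSupportingFunctional φ (x : X)) ∧
              ∀ φ : StrongDual ℝ X, IsSupportingFunctional φ (x : X) →
                ∃ g : Ω → ℝ, R.Represents g φ ∧
                  (F.symm x : Lp ℝ 1 μ) =ᵐ[μ] fun ω => |g ω| * R.toLp (x : X) ω := by

  -- A `ρ` that fails this condition is not the modulus of any admissible `X`, as such an `X`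
  -- contains a unit vector; then any `m` will do.
  by_cases hρ : (∀ τ, 0 ≤ ρ τ) ∧ Tendsto (fun τ : ℝ => ρ τ / τ) (𝓝[>] 0) (𝓝 0)
  · obtain ⟨m, hmc, hm0, hm⟩ := exists_continuous_modulus hρ.1 hρ.2
    refine ⟨fun d => m d + d, hmc.add continuous_id, by simp [hm0], ?_⟩
    intro Ω _ μ _ X _ _ _ _ R hs hX
    subst hX
    exact R.exists_entropyMap hs hmc hm0 hm
  · refine ⟨fun _ => 0, continuous_const, rfl, ?_⟩
    intro Ω _ μ _ X _ _ _ _ R hs hX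
    obtain ⟨x, hx⟩ := R.exists_norm_eq_one
    subst hX
    exact absurd ⟨smoothnessModulus_nonneg hx, hs⟩ hρ
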